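/- Let a bicolored graph be a finite simple undirected graph $G=(V,E)$ together with a partition of $V$ into a set $B$ of blue and a set $R$ of red vertices (adjacent vertices may have the same color), and let $n=|V|$. A set $H\subseteq V$ is called balanced connected if $|H\cap B|=|H\cap R|$ and either $H=\emptyset$ or the induced subgraph $G[H]$ is connected. The Balanced Connected Subgraph problem (BCS) asks, given a bicolored graph (by its number of vertices, its adjacency matrix and the indicator vector of $R$), for a balanced connected set $H$ of maximum size; thus $\emptyset$ is the answer exactly when there is no nonempty balanced connected set. Theorem. BCS can be solved on arbitrary bicolored graphs in $O^*(2^{n/2})$ time. That is, there are a deterministic program for a random access machine over the natural numbers (with addition, truncated subtraction, multiplication, integer division and remainder, indirect addressing, conditionals and loops) and constants $C,k\in\mathbb N$ such that, for every $n\ge 0$ and every bicolored graph with vertex set $\{0,\dots,n-1\}$, the program halts with the indicator vector of a maximum balanced connected set as its output, and its running time is at most $C\cdot 2^{n/2}\cdot(n+1)^k$. Running time is measured at logarithmic cost: every elementary instruction and every test costs $1$ plus the bit lengths of the numbers and addresses that it handles. -/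

import Mathlib

/-! ## The balanced connected subgraph problem

A bicolored graph is a simple graph together with its set `red` of red vertices; all other
vertices are blue. -/

/-- The vertex set `H` contains as many blue vertices as red ones. -/
def IsBalanced {V : Type*} [DecidableEq V] (red H : Finset V) : Prop :=
  (H \ red).card = (H ∩ red).card

/-- `H` induces a balanced connected subgraph of `G`. The empty vertex set is admitted
(`Preconnected`, unlike `Connected`, does not ask for a vertex), so that every instance has a
feasible solution; for nonempty `H` this is the usual connectedness of `G[H]`. -/
def IsBalancedConnected {V : Type*} [DecidableEq V] (G : SimpleGraph V) (red H : Finset V) :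
    Prop :=
  IsBalanced red H ∧ (G.induce (H : Set V)).Preconnected

/-- `H` is an optimal solution: a balanced connected vertex set of maximum size. -/
def IsMaximumBCS {V : Type*} [DecidableEq V] (G : SimpleGraph V) (red H : Finset V) : Prop :=
  IsBalancedConnected G red H ∧ ∀ H' : Finset V, IsBalancedConnected G red H' → H'.card ≤ H.card

/-! ## Random access machines with logarithmic cost -/

namespace RAM

/-- A state: registers, and a memory that can be addressed indirectly. All of them hold natural
numbers. -/
structure State where
  /-- the contents of the registers (a program mentions only finitely many of them) -/
  reg : ℕ → ℕ
  /-- the contents of the memory cells -/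
  mem : ℕ → ℕ

/-- The arithmetic operations of the machine. -/
inductive Op where
  | add
  | sub
  | mul
  | div
  | mod

/-- The operations on natural numbers: subtraction is truncated at `0`, `a div 0 = 0` and
`a mod 0 = a`. -/
def Op.eval : Op → ℕ → ℕ → ℕ
  | .add, a, b => a + b
  | .sub, a, b => a - b
  | .mul, a, b => a * b
  | .div, a, b => a / b
  | .mod, a, b => a % b

/-- Programs. -/
inductive Prog where
  /-- do nothing -/
  | skip
  /-- register `d` becomes the constant `k` -/
  | const (d k : ℕ)
  /-- register `d` becomes the result of `o` on the registers `a` and `b` -/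
  | arith (o : Op) (d a b : ℕ)
  /-- register `d` becomes the content of the memory cell whose address is in register `a` -/
  | load (d a : ℕ)
  /-- the memory cell whose address is in register `a` becomes the content of register `b` -/
  | store (a b : ℕ)
  /-- first `p`, then `q` -/
  | seq (p q : Prog)
  /-- `p` if register `r` is nonzero, otherwise `q` -/
  | ite (r : ℕ) (p q : Prog)
  /-- repeat `p` as long as register `r` is nonzero -/
  | loop (r : ℕ) (p : Prog)

/-- `Exec P s s' t`: started in state `s`, the program `P` halts in state `s'`, at total cost `t`.
Costs are logarithmic: every elementary instruction and every test costs `1` plus the number of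
bits (`Nat.size`) of the numbers and the addresses that it handles. -/
inductive Exec : Prog → State → State → ℕ → Prop where
  | skip (s : State) : Exec .skip s s 1
  | const (s : State) (d k : ℕ) :
      Exec (.const d k) s { s with reg := Function.update s.reg d k } (1 + k.size)
  | arith (s : State) (o : Op) (d a b : ℕ) :
      Exec (.arith o d a b) s
        { s with reg := Function.update s.reg d (o.eval (s.reg a) (s.reg b)) }
        (1 + (s.reg a).size + (s.reg b).size)
  | load (s : State) (d a : ℕ) :
      Exec (.load d a) s { s with reg := Function.update s.reg d (s.mem (s.reg a)) }
        (1 + (s.reg a).size + (s.mem (s.reg a)).size)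
  | store (s : State) (a b : ℕ) :
      Exec (.store a b) s { s with mem := Function.update s.mem (s.reg a) (s.reg b) }
        (1 + (s.reg a).size + (s.reg b).size)
  | seq {p q : Prog} {s₁ s₂ s₃ : State} {t u : ℕ} :
      Exec p s₁ s₂ t → Exec q s₂ s₃ u → Exec (.seq p q) s₁ s₃ (t + u)
  | iteTrue {r : ℕ} {p q : Prog} {s s' : State} {t : ℕ} :
      s.reg r ≠ 0 → Exec p s s' t → Exec (.ite r p q) s s' (1 + (s.reg r).size + t)
  | iteFalse {r : ℕ} {p q : Prog} {s s' : State} {t : ℕ} :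
      s.reg r = 0 → Exec q s s' t → Exec (.ite r p q) s s' (1 + (s.reg r).size + t)
  | loopStep {r : ℕ} {p : Prog} {s₁ s₂ s₃ : State} {t u : ℕ} :
      s₁.reg r ≠ 0 → Exec p s₁ s₂ t → Exec (.loop r p) s₂ s₃ u →
        Exec (.loop r p) s₁ s₃ (1 + (s₁.reg r).size + t + u)
  | loopStop {r : ℕ} {p : Prog} {s : State} :
      s.reg r = 0 → Exec (.loop r p) s s (1 + (s.reg r).size)

/-- The machine is deterministic: the final state and the cost are functions of the program and
the initial state. -/
theorem Exec.deterministic {P : Prog} {s s₁ : State} {t₁ : ℕ} (h₁ : Exec P s s₁ t₁) :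
    ∀ {s₂ : State} {t₂ : ℕ}, Exec P s s₂ t₂ → s₁ = s₂ ∧ t₁ = t₂ := by
  induction h₁ with
  | skip | const | arith | load | store =>
    intro s₂ t₂ h₂
    cases h₂
    exact ⟨rfl, rfl⟩
  | seq _ _ ih₁ ih₂ =>
    intro s₂ t₂ h₂
    cases h₂ with
    | seq ha hb =>
      obtain ⟨rfl, rfl⟩ := ih₁ ha
      obtain ⟨rfl, rfl⟩ := ih₂ hb
      exact ⟨rfl, rfl⟩
  | iteTrue hr _ ih =>
    intro s₂ t₂ h₂
    cases h₂ with
    | iteTrue _ ha =>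
      obtain ⟨rfl, rfl⟩ := ih ha
      exact ⟨rfl, rfl⟩
    | iteFalse h _ => exact absurd h hr
  | iteFalse hr _ ih =>
    intro s₂ t₂ h₂
    cases h₂ with
    | iteTrue h _ => exact absurd hr h
    | iteFalse _ ha =>
      obtain ⟨rfl, rfl⟩ := ih ha
      exact ⟨rfl, rfl⟩
  | loopStep hr _ _ ih₁ ih₂ =>
    intro s₂ t₂ h₂
    cases h₂ with
    | loopStep _ ha hb =>
      obtain ⟨rfl, rfl⟩ := ih₁ ha
      obtain ⟨rfl, rfl⟩ := ih₂ hb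
      exact ⟨rfl, rfl⟩
    | loopStop h => exact absurd h hr
  | loopStop hr =>
    intro s₂ t₂ h₂
    cases h₂ with
    | loopStep h _ _ => exact absurd hr h
    | loopStop _ => exact ⟨rfl, rfl⟩

end RAM

/-! ## Instances and solutions on the machine -/

open Classical in
/-- The initial state for a bicolored graph with vertices `0, …, n - 1`: register `0` holds `n`,
the cells `0, …, n ^ 2 - 1` hold the adjacency matrix row by row, the cells
`n ^ 2, …, n ^ 2 + n - 1` hold the indicator of the red vertices, and everything else is `0`. -/
noncomputable def bcsInput {n : ℕ} (G : SimpleGraph (Fin n)) (red : Finset (Fin n)) :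
    RAM.State where
  reg r := if r = 0 then n else 0
  mem a :=
    if (∃ i j : Fin n, G.Adj i j ∧ a = n * (i : ℕ) + (j : ℕ)) ∨
        (∃ v ∈ red, a = n ^ 2 + (v : ℕ))
      then 1 else 0

/-- The state `s` presents the vertex set `H` as output: the cells `0, …, n - 1` hold the
indicator of `H`. -/
def BCSOutput {n : ℕ} (s : RAM.State) (H : Finset (Fin n)) : Prop :=
  ∀ v : Fin n, s.mem (v : ℕ) = if v ∈ H then 1 else 0

/-- On every bicolored graph, the program `P` halts at cost at most `T n`, where `n` is the number
of vertices, and outputs a maximum balanced connected subgraph. -/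
def SolvesBCSInTime (P : RAM.Prog) (T : ℕ → ℝ) : Prop :=
  ∀ (n : ℕ) (G : SimpleGraph (Fin n)) (red : Finset (Fin n)),
    ∃ (s : RAM.State) (t : ℕ) (H : Finset (Fin n)),
      RAM.Exec P (bcsInput G red) s t ∧ (t : ℝ) ≤ T n ∧
        BCSOutput s H ∧ IsMaximumBCS G red H

/-! ## Running programs within a time bound -/

namespace RAM

/-! Let `M` be the smaller color class, so that `M` has at most `n / 2` members. A balanced
connected set `H` with `2 * k` vertices is a connected set with `k` vertices in `M` and `k` outside.
The algorithm tries every `Y ⊆ M` with `k` members as the trace `H ∩ M`; the rest of `H` then comes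
from outside `M`, so that `H` lies in `A = (Y ∪ Mᶜ) ∩ S`, where `S` is the set of vertices currently
selected.

For a given `Y`, such an `H` exists exactly when two conditions hold: some branching walk with `2 *
k` nodes stays in `A` and visits all of `Y`, and the vertices reachable from `Y` through `A` include
at least `k` outside `M`. A spanning tree of `H` gives the walk (`covCount_of_feasible`).
Conversely, the support of a walk is connected and has at most `k` vertices outside `M`; if it has
fewer, it can be extended one adjacent vertex at a time, without touching `M`, until there are `k`
(`exists_extension`, `feasible_of_covCount`). Thus the walk need not be injective.

Branching walks are used because they can be counted. Without the condition to visit `Y`, those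
inside `A` obey a polynomial recurrence (`sum_cov`). The condition is restored by
inclusion-exclusion: walks that visit `i` are all walks minus those that avoid `i`
(`covCount_insert`), and a walk inside `A` avoids `i ∈ Y` exactly when it fits the smaller trace
`Y.erase i`. One in-place pass per vertex over the table of all `2 ^ M.card` traces does this for
every `Y` simultaneously (`moebius_spec`). The counts have polynomially many bits (`walkCount_le`),
so logarithmic cost adds only a polynomial factor.

This decides feasibility for every `k`. With the largest feasible `k` fixed, vertices are deleted
greedily from `S` while feasibility persists; what is left is an optimal set (`search_spec`,
`isMaximumBCS_of_minimal`).

The algorithm is written in a small language of counted loops, compiled to the machine. The triples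
`Tri` prove correctness together with a cost bound read off from the syntax: loops over masks are
never nested in each other (`mainCmd_depth`), so `Cmd.cost_le` yields a single factor `2 ^ (n / 2)`.
-/

/-- Started in `s`, the program `P` halts at cost at most `t` in a state that satisfies `Q`. -/
def Ends (P : Prog) (s : State) (t : ℕ) (Q : State → Prop) : Prop :=
  ∃ s' u, Exec P s s' u ∧ u ≤ t ∧ Q s'

theorem Ends.mono {P : Prog} {s : State} {t t' : ℕ} {Q Q' : State → Prop}
    (h : Ends P s t Q) (ht : t ≤ t') (hQ : ∀ s', Q s' → Q' s') : Ends P s t' Q' := by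
  obtain ⟨s', u, h1, h2, h3⟩ := h
  exact ⟨s', u, h1, h2.trans ht, hQ _ h3⟩

theorem Ends.seq {p q : Prog} {s : State} {t u : ℕ} {Q : State → Prop}
    (h : Ends p s t (fun s' => Ends q s' u Q)) : Ends (.seq p q) s (t + u) Q := by
  obtain ⟨s', u', h1, h2, s'', u'', h3, h4, h5⟩ := h
  exact ⟨s'', u' + u'', .seq h1 h3, by omega, h5⟩

/-- The cost of an elementary instruction on numbers below `2 ^ (L + 4)`. -/
def stepCost (L : ℕ) : ℕ := 2 * (L + 4) + 1

theorem Ends.const {s : State} {L d k : ℕ} {Q : State → Prop} (hk : k < 2 ^ (L + 4))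
    (hQ : Q { s with reg := Function.update s.reg d k }) :
    Ends (.const d k) s (stepCost L) Q := by
  have := Nat.size_le.2 hk
  exact ⟨_, _, .const s d k, by unfold stepCost; omega, hQ⟩

theorem Ends.arith {s : State} {L d a b : ℕ} {o : Op} {Q : State → Prop}
    (ha : s.reg a < 2 ^ (L + 4)) (hb : s.reg b < 2 ^ (L + 4))
    (hQ : Q { s with reg := Function.update s.reg d (o.eval (s.reg a) (s.reg b)) }) :
    Ends (.arith o d a b) s (stepCost L) Q := by
  have h1 := Nat.size_le.2 ha
  have h2 := Nat.size_le.2 hb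
  exact ⟨_, _, .arith s o d a b, by unfold stepCost; omega, hQ⟩

theorem Ends.load {s : State} {L d a : ℕ} {Q : State → Prop}
    (ha : s.reg a < 2 ^ (L + 4)) (hb : s.mem (s.reg a) < 2 ^ (L + 4))
    (hQ : Q { s with reg := Function.update s.reg d (s.mem (s.reg a)) }) :
    Ends (.load d a) s (stepCost L) Q := by
  have h1 := Nat.size_le.2 ha
  have h2 := Nat.size_le.2 hb
  exact ⟨_, _, .load s d a, by unfold stepCost; omega, hQ⟩

theorem Ends.store {s : State} {L a b : ℕ} {Q : State → Prop}
    (ha : s.reg a < 2 ^ (L + 4)) (hb : s.reg b < 2 ^ (L + 4))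
    (hQ : Q { s with mem := Function.update s.mem (s.reg a) (s.reg b) }) :
    Ends (.store a b) s (stepCost L) Q := by
  have h1 := Nat.size_le.2 ha
  have h2 := Nat.size_le.2 hb
  exact ⟨_, _, .store s a b, by unfold stepCost; omega, hQ⟩

theorem Ends.skip {s : State} {L : ℕ} {Q : State → Prop} (hQ : Q s) :
    Ends .skip s (stepCost L) Q :=
  ⟨_, _, .skip s, by unfold stepCost; omega, hQ⟩

theorem Ends.ite {s : State} {L r t u : ℕ} {p q : Prog} {Q : State → Prop}
    (hr : s.reg r < 2 ^ (L + 4)) (h1 : s.reg r ≠ 0 → Ends p s t Q)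
    (h2 : s.reg r = 0 → Ends q s u Q) :
    Ends (.ite r p q) s (stepCost L + t + u) Q := by
  have h := Nat.size_le.2 hr
  by_cases h0 : s.reg r = 0
  · obtain ⟨s', w, a, b, c⟩ := h2 h0
    exact ⟨s', _, .iteFalse h0 a, by unfold stepCost; omega, c⟩
  · obtain ⟨s', w, a, b, c⟩ := h1 h0
    exact ⟨s', _, .iteTrue h0 a, by unfold stepCost; omega, c⟩

/-- A loop whose register `r` counts down from `m`. -/
theorem Ends.loop {r L t m : ℕ} {p : Prog} (I : ℕ → State → Prop) (hm : m < 2 ^ (L + 4))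
    (hr : ∀ i s, I i s → s.reg r = m - i)
    (hp : ∀ i s, i < m → I i s → Ends p s t (I (i + 1))) {s : State} (h0 : I 0 s) :
    Ends (.loop r p) s ((m + 1) * stepCost L + m * t) (I m) := by
  -- The induction is on the number `j` of rounds still to come, because `Exec.loopStep` splits off
  -- the first round.
  have key : ∀ j i s, i + j = m → I i s →
      Ends (.loop r p) s ((j + 1) * stepCost L + j * t) (I m) := by
    intro j
    induction j with
    | zero =>
      intro i s hi hI
      have hz : s.reg r = 0 := by rw [hr i s hI]; omega
      obtain rfl : i = m := by omega
      exact ⟨s, _, .loopStop hz, by rw [hz]; simp [stepCost], hI⟩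
    | succ j ih =>
      intro i s hi hI
      have hz : s.reg r = j + 1 := by rw [hr i s hI]; omega
      have hs : (s.reg r).size ≤ L + 4 := Nat.size_le.2 (by omega)
      obtain ⟨s', u, h1, h2, h3⟩ := hp i s (by omega) hI
      obtain ⟨s'', u', h4, h5, h6⟩ := ih (i + 1) s' (by omega) h3
      refine ⟨s'', _, .loopStep (by omega) h1 h4, ?_, h6⟩
      have e1 : (j + 1 + 1) * stepCost L = (j + 1) * stepCost L + stepCost L := by ring
      have e2 : (j + 1) * t = j * t + t := by ring
      have e3 : 1 + (s.reg r).size ≤ stepCost L := by unfold stepCost; omega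
      omega
  simpa using key m 0 s (by omega) h0

end RAM

/-! ## A language with arrays and counted loops -/

namespace ForLang

open RAM (Op State Prog Exec Ends stepCost)

/-- The variables. -/
inductive Var where
  | n | q | n1 | n2 | c | v | u | t | s | X | acc | pc | k | best | ok | r | i | j | z
  deriving DecidableEq

/-- The arrays. -/
inductive Arr where
  | S | P | A | W | T | Q
  deriving DecidableEq

/-- The position of a variable among the registers. -/
def Var.idx (x : Var) : ℕ := x.ctorIdx

theorem Var.idx_injective : Function.Injective Var.idx := by
  intro x y h
  cases x <;> cases y <;> first | rfl | cases h

/-- The offset of an array. -/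
def Arr.idx (a : Arr) : ℕ := a.ctorIdx

theorem Arr.idx_injective : Function.Injective Arr.idx := by
  intro x y h
  cases x <;> cases y <;> first | rfl | cases h

theorem Arr.idx_lt (a : Arr) : a.idx < 8 := by
  cases a <;> decide

/-- Expressions; `inp e` reads the cell `e` of the input region of the memory. -/
inductive Ex where
  | var (x : Var)
  | lit (k : ℕ)
  | op (o : Op) (a b : Ex)
  | arr (a : Arr) (e : Ex)
  | inp (e : Ex)

/-- Commands. `out a b` writes to the input region; the flag of a loop tells whether its number of
iterations may be large. -/
inductive Cmd where
  | skip
  | assign (x : Var) (e : Ex)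
  | store (a : Arr) (i e : Ex)
  | out (i e : Ex)
  | seq (c d : Cmd)
  | ite (e : Ex) (c d : Cmd)
  | loop (big : Bool) (x : Var) (e : Ex) (c : Cmd)

infixr:60 " ;; " => Cmd.seq

/-- States of the language. -/
structure St where
  /-- the variables -/
  v : Var → ℕ
  /-- the arrays -/
  arr : Arr → ℕ → ℕ
  /-- the input region -/
  inp : ℕ → ℕ

/-- Assignment to a variable. -/
def St.setV (σ : St) (x : Var) (k : ℕ) : St := { σ with v := Function.update σ.v x k }

/-- Assignment to an array cell. -/
def St.setA (σ : St) (a : Arr) (i k : ℕ) : St :=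
  { σ with arr := Function.update σ.arr a (Function.update (σ.arr a) i k) }

/-- Assignment to a cell of the input region. -/
def St.setI (σ : St) (i k : ℕ) : St := { σ with inp := Function.update σ.inp i k }

@[simp] theorem St.setV_v (σ : St) (x y : Var) (k : ℕ) :
    (σ.setV x k).v y = if y = x then k else σ.v y := by
  simp [St.setV, Function.update_apply]

@[simp] theorem St.setV_arr (σ : St) (x : Var) (k : ℕ) : (σ.setV x k).arr = σ.arr := rfl

@[simp] theorem St.setV_inp (σ : St) (x : Var) (k : ℕ) : (σ.setV x k).inp = σ.inp := rfl

@[simp] theorem St.setA_v (σ : St) (a : Arr) (i k : ℕ) : (σ.setA a i k).v = σ.v := rfl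

theorem St.setA_arr (σ : St) (a b : Arr) (i j k : ℕ) :
    (σ.setA a i k).arr b j = if b = a ∧ j = i then k else σ.arr b j := by
  by_cases h : b = a
  · subst h
    simp [St.setA, Function.update_apply]
  · simp [St.setA, h]

@[simp] theorem St.setA_arr_self (σ : St) (a : Arr) (i j k : ℕ) :
    (σ.setA a i k).arr a j = if j = i then k else σ.arr a j := by
  simp [St.setA_arr]

theorem St.setA_arr_of_ne (σ : St) {a b : Arr} (h : b ≠ a) (i k : ℕ) :
    (σ.setA a i k).arr b = σ.arr b := by
  funext j
  simp [St.setA_arr, h]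

@[simp] theorem St.setA_inp (σ : St) (a : Arr) (i k : ℕ) : (σ.setA a i k).inp = σ.inp := rfl

@[simp] theorem St.setI_arr (σ : St) (i k : ℕ) : (σ.setI i k).arr = σ.arr := rfl

@[simp] theorem St.setI_inp (σ : St) (i j k : ℕ) :
    (σ.setI i k).inp j = if j = i then k else σ.inp j := by
  simp [St.setI, Function.update_apply]

/-- The value of an expression. -/
def Ex.eval (σ : St) : Ex → ℕ
  | .var x => σ.v x
  | .lit k => k
  | .op o a b => o.eval (a.eval σ) (b.eval σ)
  | .arr a e => σ.arr a (e.eval σ)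
  | .inp e => σ.inp (e.eval σ)

/-- Parameters of a run: size of the input region, bound on the bit lengths, bounds for the numbers
of iterations of ordinary and of big loops. -/
structure Par where
  /-- the size of the input region -/
  N : ℕ
  /-- bound on the bit lengths -/
  L : ℕ
  /-- bound for ordinary loops -/
  p : ℕ
  /-- bound for big loops -/
  g : ℕ
  N_lt : N < 2 ^ L

/-- No number that occurs in the evaluation is too large, and the input region is respected. -/
def Ex.Safe (π : Par) (σ : St) : Ex → Prop
  | .var _ => True
  | .lit k => k < 2 ^ π.L
  | .op o a b => a.Safe π σ ∧ b.Safe π σ ∧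
      match o with
      | .add => a.eval σ + b.eval σ < 2 ^ π.L
      | .mul => a.eval σ * b.eval σ < 2 ^ π.L
      | _ => True
  | .arr _ e => e.Safe π σ
  | .inp e => e.Safe π σ ∧ e.eval σ < π.N

/-- All numbers in the state are small. -/
structure St.Bdd (π : Par) (σ : St) : Prop where
  v : ∀ x, σ.v x < 2 ^ π.L
  arr : ∀ a i, σ.arr a i < 2 ^ π.L
  inp : ∀ i, σ.inp i < 2 ^ π.L

/-- Differences, quotients and remainders never exceed their left operand, also for divisor `0`.
This is why `Ex.Safe` bounds only sums and products. -/
theorem Ex.eval_lt {π : Par} {σ : St} (hσ : σ.Bdd π) :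
    ∀ {e : Ex}, e.Safe π σ → e.eval σ < 2 ^ π.L
  | .var x, _ => hσ.v x
  | .lit _, h => h
  | .op .add _ _, h => h.2.2
  | .op .mul _ _, h => h.2.2
  | .op .sub _ _, h => (Nat.sub_le _ _).trans_lt (Ex.eval_lt hσ h.1)
  | .op .div _ _, h => (Nat.div_le_self _ _).trans_lt (Ex.eval_lt hσ h.1)
  | .op .mod _ _, h => (Nat.mod_le _ _).trans_lt (Ex.eval_lt hσ h.1)
  | .arr a _, _ => hσ.arr a _
  | .inp _, _ => hσ.inp _

/-! ### Compiling expressions -/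

/-- Code that turns the index in register `2 * d + 1` into an address of the array `a`. -/
def addrComp (a : Arr) (d : ℕ) (p : Prog) : Prog :=
  .seq (.const (2 * d + 3) 8) (.seq (.arith .mul (2 * d + 1) (2 * d + 1) (2 * d + 3))
    (.seq (.arith .add (2 * d + 1) 1 (2 * d + 1)) (.seq (.const (2 * d + 3) a.idx)
      (.seq (.arith .add (2 * d + 1) (2 * d + 1) (2 * d + 3)) p))))

/-- Code that evaluates an expression into register `2 * d + 1`. -/
def Ex.comp : Ex → ℕ → Prog
  | .var x, d => .seq (.const (2 * d + 1) 0) (.arith .add (2 * d + 1) (2 * d + 1) (2 * x.idx))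
  | .lit k, d => .const (2 * d + 1) k
  | .op o a b, d => .seq (a.comp d) (.seq (b.comp (d + 1))
      (.arith o (2 * d + 1) (2 * d + 1) (2 * d + 3)))
  | .arr a e, d => .seq (e.comp d) (addrComp a d (.load (2 * d + 1) (2 * d + 1)))
  | .inp e, d => .seq (e.comp d) (.load (2 * d + 1) (2 * d + 1))

/-- The number of instructions in the evaluation of an expression. -/
def Ex.cost : Ex → ℕ
  | .var _ => 2
  | .lit _ => 1
  | .op _ a b => a.cost + b.cost + 1
  | .arr _ e => e.cost + 6
  | .inp e => e.cost + 1

/-- The machine state `s` represents `σ`. -/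
structure Rel (π : Par) (σ : St) (s : State) : Prop where
  v : ∀ x : Var, s.reg (2 * x.idx) = σ.v x
  base : s.reg 1 = π.N
  arr : ∀ (a : Arr) (i : ℕ), s.mem (π.N + 8 * i + a.idx) = σ.arr a i
  inp : ∀ i, i < π.N → s.mem i = σ.inp i

/-- Registers that code at level `d` does not change (other than the variables). -/
def Keep (d : ℕ) (s s' : State) : Prop := ∀ r, r % 2 = 1 → r < 2 * d + 1 → s'.reg r = s.reg r

/-- The effect of evaluating an expression. -/
structure Ex.Post (e : Ex) (d : ℕ) (σ : St) (s s' : State) : Prop where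
  mem : s'.mem = s.mem
  val : s'.reg (2 * d + 1) = e.eval σ
  reg : ∀ r, r % 2 = 0 ∨ r < 2 * d + 1 → s'.reg r = s.reg r

/-- At level `d ≥ 1` evaluation changes only odd registers from `3` on. The variables sit in even
registers and the base address in register `1`, so the represented state is untouched. -/
theorem Ex.Post.rel {e : Ex} {d : ℕ} {σ : St} {s s' : State} {π : Par} (h : e.Post d σ s s')
    (hd : 1 ≤ d) (hs : Rel π σ s) : Rel π σ s' where
  v x := by rw [h.reg _ (by omega), hs.v]
  base := by rw [h.reg _ (by omega), hs.base]
  arr a i := by rw [h.mem, hs.arr]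
  inp i hi := by rw [h.mem, hs.inp i hi]

/-- Values of the language stay below `2 ^ L`, but the machine also handles the stride `8` and
addresses `π.N + 8 * i + a.idx`; the factor `16` leaves room for both. -/
theorem two_pow_add_four (L : ℕ) : 2 ^ (L + 4) = 16 * 2 ^ L := by ring

/-- The odd registers serve as a stack: a second operand is evaluated at level `d + 1`, which
preserves the first result in register `2 * d + 1`. -/
theorem Ex.ends {π : Par} {σ : St} (hσ : σ.Bdd π) (e : Ex) :
    ∀ {d : ℕ} {s : State}, 1 ≤ d → Rel π σ s → e.Safe π σ →
      Ends (e.comp d) s (e.cost * stepCost π.L) (e.Post d σ s) := by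
  have h16 := two_pow_add_four π.L
  have hN := π.N_lt
  induction e with
  | var x =>
    intro d s hd hs _
    have h1 := hσ.v x
    refine Ends.mono (Ends.seq (Ends.const (L := π.L) (by omega)
      (Ends.arith (L := π.L) ?_ ?_ ⟨rfl, ?_, ?_⟩))) (le_of_eq (by simp only [cost]; ring))
      fun _ h => h
    · simp
    · have : 2 * x.idx ≠ 2 * d + 1 := by omega
      simp [this, hs.v]; omega
    · have : 2 * x.idx ≠ 2 * d + 1 := by omega
      simp [this, hs.v, Op.eval, eval]
    · intro r hr
      have : r ≠ 2 * d + 1 := by omega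
      simp [this]
  | lit k =>
    intro d s hd hs hk
    have hk' : k < 2 ^ π.L := hk
    refine Ends.mono (Ends.const (L := π.L) (by omega) ⟨rfl, ?_, ?_⟩)
      (le_of_eq (by simp only [cost]; ring)) fun _ h => h
    · simp [eval]
    · intro r hr
      have : r ≠ 2 * d + 1 := by omega
      simp [this]
  | op o a b iha ihb =>
    intro d s hd hs hk
    have ha := Ex.eval_lt hσ hk.1
    have hb := Ex.eval_lt hσ hk.2.1
    refine Ends.mono (Ends.seq (Ends.mono (iha hd hs hk.1) le_rfl fun s1 h1 =>
      Ends.seq (Ends.mono (ihb (d := d + 1) (by omega) (h1.rel hd hs) hk.2.1) le_rfl fun s2 h2 =>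
      Ends.arith (L := π.L) ?_ ?_ ⟨?_, ?_, ?_⟩))) (le_of_eq (by simp only [cost]; ring))
      fun _ h => h
    · rw [h2.reg _ (by omega), h1.val]; omega
    · rw [show 2 * d + 3 = 2 * (d + 1) + 1 by ring, h2.val]; omega
    · simp [h1.mem, h2.mem]
    · simp only [Function.update_self]
      rw [h2.reg _ (by omega), h1.val, show 2 * d + 3 = 2 * (d + 1) + 1 by ring, h2.val]; rfl
    · intro r hr
      have : r ≠ 2 * d + 1 := by omega
      simp only [ne_eq, this, not_false_eq_true, Function.update_of_ne]
      rw [h2.reg _ (by omega), h1.reg _ (by omega)]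
  | arr a e ih =>
    intro d s hd hs hk
    have he := Ex.eval_lt hσ (e := e) hk
    have hv := hσ.arr a (e.eval σ)
    have ha := a.idx_lt
    have hne : 2 * d + 1 ≠ 2 * d + 3 := by omega
    have hd0 : d ≠ 0 := by omega
    have hpos : 0 < 2 ^ π.L := by positivity
    refine Ends.mono (Ends.seq (Ends.mono (ih hd hs hk) le_rfl fun s1 h1 =>
      Ends.seq (Ends.const (L := π.L) ?_ (Ends.seq (Ends.arith (L := π.L) ?_ ?_
      (Ends.seq (Ends.arith (L := π.L) ?_ ?_ (Ends.seq (Ends.const (L := π.L) ?_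
      (Ends.seq (Ends.arith (L := π.L) ?_ ?_
      (Ends.load (L := π.L) ?_ ?_ ⟨?_, ?_, ?_⟩))))))))))))
      (le_of_eq (by simp only [cost]; ring)) fun _ h => h
    all_goals
      have hb := (h1.rel hd hs).base
      have hm := (h1.rel hd hs).arr a (e.eval σ)
      have hev := h1.val
    · omega
    · simp; omega
    · simp; omega
    · simp [hd0, hb]; omega
    · simp [hev, Op.eval]; omega
    · omega
    · simp [hev, Op.eval, hd0, hb]; omega
    · simp; omega
    · simp [hev, Op.eval, hd0, hb]; omega
    · simp [hev, Op.eval, hd0, hb]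
      rw [mul_comm _ 8, hm]; omega
    · simp [h1.mem]
    · simp [hev, Op.eval, hd0, hb]
      rw [mul_comm _ 8, hm]; rfl
    · intro r hr
      have h2 : r ≠ 2 * d + 1 := by omega
      have h3 : r ≠ 2 * d + 3 := by omega
      simp [h2, h3, h1.reg r hr]
  | inp e ih =>
    intro d s hd hs hk
    have he := Ex.eval_lt hσ hk.1
    have hv := hσ.inp (e.eval σ)
    refine Ends.mono (Ends.seq (Ends.mono (ih hd hs hk.1) le_rfl fun s1 h1 =>
      Ends.load (L := π.L) ?_ ?_ ⟨?_, ?_, ?_⟩)) (le_of_eq (by simp only [cost]; ring)) fun _ h => h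
    all_goals
      have hm := (h1.rel hd hs).inp _ hk.2
      have hev := h1.val
    · omega
    · rw [hev, hm]; omega
    · exact h1.mem
    · simp [hev, hm, eval]
    · intro r hr
      have h2 : r ≠ 2 * d + 1 := by omega
      simp [h2, h1.reg r hr]

/-! ### Compiling commands -/

/-- Code for a command at level `d`. -/
def Cmd.comp : Cmd → ℕ → Prog
  | .skip, _ => .skip
  | .assign x e, d => .seq (e.comp d) (.seq (.const (2 * d + 3) 0)
      (.arith .add (2 * x.idx) (2 * d + 1) (2 * d + 3)))
  | .store a i e, d => .seq (i.comp d) (addrComp a d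
      (.seq (e.comp (d + 1)) (.store (2 * d + 1) (2 * d + 3))))
  | .out i e, d => .seq (i.comp d) (.seq (e.comp (d + 1)) (.store (2 * d + 1) (2 * d + 3)))
  | .seq c c', d => .seq (c.comp d) (c'.comp d)
  | .ite e c c', d => .seq (e.comp d) (.ite (2 * d + 1) (c.comp d) (c'.comp d))
  | .loop _ x e c, d => .seq (e.comp d) (.seq (.const (2 * x.idx) 0) (.loop (2 * d + 1)
      (.seq (c.comp (d + 1)) (.seq (.const (2 * d + 3) 1)
        (.seq (.arith .add (2 * x.idx) (2 * x.idx) (2 * d + 3))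
          (.arith .sub (2 * d + 1) (2 * d + 1) (2 * d + 3)))))))

/-- Bound for the number of iterations of a loop. -/
def Par.bound (π : Par) (big : Bool) : ℕ := if big then π.g else π.p

/-- Bound for the number of instructions that a command executes. -/
def Cmd.cost (π : Par) : Cmd → ℕ
  | .skip => 1
  | .assign _ e => e.cost + 2
  | .store _ i e => i.cost + e.cost + 6
  | .out i e => i.cost + e.cost + 1
  | .seq c c' => c.cost π + c'.cost π
  | .ite e c c' => e.cost + 1 + c.cost π + c'.cost π
  | .loop big _ e c => e.cost + 2 + π.bound big * (c.cost π + 4)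

/-- Does the command change the variable `y`? -/
def Cmd.wv (y : Var) : Cmd → Bool
  | .skip => false
  | .assign x _ => y = x
  | .store _ _ _ => false
  | .out _ _ => false
  | .seq c c' => c.wv y || c'.wv y
  | .ite _ c c' => c.wv y || c'.wv y
  | .loop _ x _ c => y = x || c.wv y

/-- Does the command change the array `b`? -/
def Cmd.wa (b : Arr) : Cmd → Bool
  | .skip => false
  | .assign _ _ => false
  | .store a _ _ => b = a
  | .out _ _ => false
  | .seq c c' => c.wa b || c'.wa b
  | .ite _ c c' => c.wa b || c'.wa b
  | .loop _ _ _ c => c.wa b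

/-- Does the command change the input region? -/
def Cmd.wi : Cmd → Bool
  | .skip => false
  | .assign _ _ => false
  | .store _ _ _ => false
  | .out _ _ => true
  | .seq c c' => c.wi || c'.wi
  | .ite _ c c' => c.wi || c'.wi
  | .loop _ _ _ c => c.wi

/-- The states differ at most where `c` writes. -/
structure Frame (c : Cmd) (σ τ : St) : Prop where
  v : ∀ x, c.wv x = false → τ.v x = σ.v x
  arr : ∀ a, c.wa a = false → τ.arr a = σ.arr a
  inp : c.wi = false → τ.inp = σ.inp

theorem Frame.refl (c : Cmd) (σ : St) : Frame c σ σ :=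
  ⟨fun _ _ => rfl, fun _ _ => rfl, fun _ => rfl⟩

theorem Frame.trans {c c₁ c₂ : Cmd} {σ τ ρ : St} (h₁ : Frame c₁ σ τ) (h₂ : Frame c₂ τ ρ)
    (hv : ∀ x, c.wv x = false → c₁.wv x = false ∧ c₂.wv x = false)
    (ha : ∀ x, c.wa x = false → c₁.wa x = false ∧ c₂.wa x = false)
    (hi : c.wi = false → c₁.wi = false ∧ c₂.wi = false) : Frame c σ ρ where
  v x hx := (h₂.v x (hv x hx).2).trans (h₁.v x (hv x hx).1)
  arr x hx := (h₂.arr x (ha x hx).2).trans (h₁.arr x (ha x hx).1)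
  inp hx := (h₂.inp (hi hx).2).trans (h₁.inp (hi hx).1)

theorem Frame.mono {c c₁ : Cmd} {σ τ : St} (h₁ : Frame c₁ σ τ)
    (hv : ∀ x, c.wv x = false → c₁.wv x = false)
    (ha : ∀ x, c.wa x = false → c₁.wa x = false)
    (hi : c.wi = false → c₁.wi = false) : Frame c σ τ where
  v x hx := h₁.v x (hv x hx)
  arr x hx := h₁.arr x (ha x hx)
  inp hx := h₁.inp (hi hx)

/-! ### Proof rules for total correctness with cost -/

/-- What is known after running `c` from `σ` at level `d` (started in the machine state `s`, halted
in `s'`). -/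
def Outcome (π : Par) (c : Cmd) (σ : St) (Q : St → Prop) (d : ℕ) (s s' : State) : Prop :=
  ∃ τ, τ.Bdd π ∧ Q τ ∧ Frame c σ τ ∧ Rel π τ s' ∧ Keep d s s'

/-- Total correctness: started in `σ`, the command halts within its cost bound in a state that
satisfies `Q`. -/
def Tri (π : Par) (c : Cmd) (σ : St) (Q : St → Prop) : Prop :=
  σ.Bdd π → ∀ d s, 1 ≤ d → Rel π σ s →
    Ends (c.comp d) s (c.cost π * stepCost π.L) (Outcome π c σ Q d s)

theorem Tri.mono {π : Par} {c : Cmd} {σ : St} {Q Q' : St → Prop} (h : Tri π c σ Q)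
    (hQ : ∀ τ, τ.Bdd π → Frame c σ τ → Q τ → Q' τ) : Tri π c σ Q' :=
  fun hσ d s hd hs => (h hσ d s hd hs).mono le_rfl
    fun _ ⟨τ, h1, h2, h3, h4⟩ => ⟨τ, h1, hQ τ h1 h3 h2, h3, h4⟩

theorem Tri.skip {π : Par} {σ : St} {Q : St → Prop} (h : Q σ) : Tri π .skip σ Q :=
  fun hσ _ _ _ hs => Ends.mono (Ends.skip (L := π.L)
    ⟨σ, hσ, h, Frame.refl _ _, hs, fun _ _ _ => rfl⟩) (by simp [Cmd.cost]) fun _ h => h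

theorem Rel.setV {π : Par} {σ : St} {s : State} (hs : Rel π σ s) (x : Var) (k : ℕ) :
    Rel π (σ.setV x k) { s with reg := Function.update s.reg (2 * x.idx) k } where
  v y := by
    have : 2 * y.idx = 2 * x.idx ↔ y = x :=
      ⟨fun h => Var.idx_injective (by omega), fun h => by rw [h]⟩
    simp [Function.update_apply, this, hs.v]
  base := by
    have : 1 ≠ 2 * x.idx := by omega
    simp [this, hs.base]
  arr := hs.arr
  inp := hs.inp

theorem Rel.temp {π : Par} {σ : St} {s : State} (hs : Rel π σ s) {r : ℕ} (hr : r % 2 = 1)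
    (h1 : 1 < r) (k : ℕ) : Rel π σ { s with reg := Function.update s.reg r k } where
  v y := by
    have : 2 * y.idx ≠ r := by omega
    simp [this, hs.v]
  base := by
    have : 1 ≠ r := by omega
    simp [this, hs.base]
  arr := hs.arr
  inp := hs.inp

/-- The arrays are interleaved with stride `8`, which leaves each of them unbounded. As the offsets
are below `8`, an address determines array and index, and addresses from `π.N` on miss the input
region. -/
theorem Rel.setA {π : Par} {σ : St} {s : State} (hs : Rel π σ s) (a : Arr) (i k : ℕ) :
    Rel π (σ.setA a i k) { s with mem := Function.update s.mem (π.N + 8 * i + a.idx) k } where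
  v := hs.v
  base := hs.base
  arr b j := by
    have ha := a.idx_lt
    have hb := b.idx_lt
    have : π.N + 8 * j + b.idx = π.N + 8 * i + a.idx ↔ b = a ∧ j = i :=
      ⟨fun h => ⟨Arr.idx_injective (by omega), by omega⟩, fun h => by rw [h.1, h.2]⟩
    simp [Function.update_apply, this, hs.arr, St.setA_arr]
  inp j hj := by
    have : j ≠ π.N + 8 * i + a.idx := by omega
    simp [this, hs.inp j hj]

theorem Rel.setI {π : Par} {σ : St} {s : State} (hs : Rel π σ s) {i : ℕ} (hi : i < π.N) (k : ℕ) :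
    Rel π (σ.setI i k) { s with mem := Function.update s.mem i k } where
  v := hs.v
  base := hs.base
  arr b j := by
    have : π.N + 8 * j + b.idx ≠ i := by omega
    simp [this, hs.arr]
  inp j hj := by simp [Function.update_apply, hs.inp j hj]

theorem St.Bdd.setV {π : Par} {σ : St} (h : σ.Bdd π) (x : Var) {k : ℕ} (hk : k < 2 ^ π.L) :
    (σ.setV x k).Bdd π where
  v y := by
    rw [St.setV_v]
    split
    · exact hk
    · exact h.v y
  arr := h.arr
  inp := h.inp

theorem Tri.assign {π : Par} {x : Var} {e : Ex} {σ : St} {Q : St → Prop} (he : e.Safe π σ)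
    (hQ : Q (σ.setV x (e.eval σ))) : Tri π (.assign x e) σ Q := by
  intro hσ d s hd hs
  have h16 := two_pow_add_four π.L
  have hlt := Ex.eval_lt hσ he
  refine Ends.mono (Ends.seq (Ends.mono (e.ends hσ hd hs he) le_rfl fun s1 h1 =>
    Ends.seq (Ends.const (L := π.L) (by simp) (Ends.arith (L := π.L) ?_ ?_ ?_))))
    (le_of_eq (by simp only [Cmd.cost]; ring)) fun _ h => h
  · simp [h1.val]; omega
  · simp
  · refine ⟨_, hσ.setV x hlt, hQ, ⟨?_, fun _ _ => rfl, fun _ => rfl⟩, ?_, ?_⟩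
    · intro y hy
      have : y ≠ x := by simpa [Cmd.wv] using hy
      simp [this]
    · have := ((h1.rel hd hs).temp (r := 2 * d + 3) (by omega) (by omega) 0).setV x (e.eval σ)
      simpa [h1.val, Op.eval, mul_add] using this
    · intro r hr1 hr
      have h2 : r ≠ 2 * x.idx := by omega
      have h3 : r ≠ 2 * d + 3 := by omega
      simp [h2, h3, h1.reg r (.inr hr)]

theorem Tri.store {π : Par} {a : Arr} {i e : Ex} {σ : St} {Q : St → Prop} (hi : i.Safe π σ)
    (he : e.Safe π σ) (hQ : Q (σ.setA a (i.eval σ) (e.eval σ))) : Tri π (.store a i e) σ Q := by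
  intro hσ d s hd hs
  have h16 := two_pow_add_four π.L
  have hlt := Ex.eval_lt hσ he
  have hlti := Ex.eval_lt hσ hi
  have ha := a.idx_lt
  have hN := π.N_lt
  have hd0 : d ≠ 0 := by omega
  refine Ends.mono (Ends.seq (Ends.mono (i.ends hσ hd hs hi) le_rfl fun s1 h1 =>
    Ends.seq (Ends.const (L := π.L) ?_ (Ends.seq (Ends.arith (L := π.L) ?_ ?_
    (Ends.seq (Ends.arith (L := π.L) ?_ ?_ (Ends.seq (Ends.const (L := π.L) ?_
    (Ends.seq (Ends.arith (L := π.L) ?_ ?_ (Ends.seq (Ends.mono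
      (e.ends (d := d + 1) hσ (by omega) ?_ he) le_rfl fun s2 h2 =>
      Ends.store (L := π.L) ?_ ?_ ?_)))))))))))))
    (le_of_eq (by simp only [Cmd.cost]; ring)) fun _ h => h
  all_goals
    have hb := (h1.rel hd hs).base
    have hev := h1.val
  · omega
  · simp; omega
  · simp; omega
  · simp [hd0, hb]; omega
  · simp [hev, Op.eval]; omega
  · omega
  · simp [hev, Op.eval, hd0, hb]; omega
  · simp; omega
  · exact ((((((h1.rel hd hs).temp (by omega) (by omega) _).temp (by omega) (by omega) _).temp
      (by omega) (by omega) _).temp (by omega) (by omega) _).temp (by omega) (by omega) _)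
  all_goals
    have hadr := h2.reg (2 * d + 1) (by omega)
    have hval : s2.reg (2 * d + 3) = e.eval σ := h2.val
    simp [hev, Op.eval, hd0, hb, mul_comm (i.eval σ)] at hadr
  · omega
  · omega
  · have hmem : s2.mem = s1.mem := h2.mem
    have h3 : Rel π σ s2 := by
      refine ⟨fun x => ?_, ?_, fun b j => ?_, fun j hj => ?_⟩
      · have h5 : 2 * x.idx ≠ 2 * d + 1 := by omega
        have h6 : 2 * x.idx ≠ 2 * d + 3 := by omega
        rw [h2.reg _ (by omega)]
        simp [h5, h6, (h1.rel hd hs).v]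
      · rw [h2.reg _ (by omega)]
        simp [hd0, hb]
      · rw [hmem, (h1.rel hd hs).arr]
      · rw [hmem, (h1.rel hd hs).inp j hj]
    have h4 : (σ.setA a (i.eval σ) (e.eval σ)).Bdd π := by
      refine ⟨hσ.v, fun b j => ?_, hσ.inp⟩
      rw [St.setA_arr]
      split
      · exact hlt
      · exact hσ.arr b j
    refine ⟨_, h4, hQ, ⟨fun _ _ => rfl, ?_, fun _ => rfl⟩, ?_, ?_⟩
    · intro b hb
      exact St.setA_arr_of_ne _ (by simpa [Cmd.wa] using hb) _ _
    · rw [hadr, hval]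
      exact h3.setA a _ _
    · intro r hr1 hr
      have h5 : r ≠ 2 * d + 1 := by omega
      have h6 : r ≠ 2 * d + 3 := by omega
      simp only
      rw [h2.reg _ (by omega)]
      simp [h5, h6, h1.reg r (.inr hr)]

theorem Tri.out {π : Par} {i e : Ex} {σ : St} {Q : St → Prop} (hi : i.Safe π σ)
    (he : e.Safe π σ) (hlt : i.eval σ < π.N) (hQ : Q (σ.setI (i.eval σ) (e.eval σ))) :
    Tri π (.out i e) σ Q := by
  intro hσ d s hd hs
  have h16 := two_pow_add_four π.L
  have hlte := Ex.eval_lt hσ he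
  have hN := π.N_lt
  refine Ends.mono (Ends.seq (Ends.mono (i.ends hσ hd hs hi) le_rfl fun s1 h1 =>
    Ends.seq (Ends.mono (e.ends (d := d + 1) hσ (by omega) (h1.rel hd hs) he) le_rfl fun s2 h2 =>
      Ends.store (L := π.L) ?_ ?_ ?_)))
    (le_of_eq (by simp only [Cmd.cost]; ring)) fun _ h => h
  all_goals
    have hadr := h2.reg (2 * d + 1) (by omega)
    rw [h1.val] at hadr
    have hval : s2.reg (2 * d + 3) = e.eval σ := h2.val
  · omega
  · omega
  · have h4 : (σ.setI (i.eval σ) (e.eval σ)).Bdd π := by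
      refine ⟨hσ.v, hσ.arr, fun j => ?_⟩
      rw [St.setI_inp]
      split
      · exact hlte
      · exact hσ.inp j
    refine ⟨_, h4, hQ, ⟨fun _ _ => rfl, fun _ _ => rfl, fun h => by simp [Cmd.wi] at h⟩, ?_, ?_⟩
    · rw [hadr, hval]
      exact (h2.rel (by omega) (h1.rel hd hs)).setI hlt _
    · intro r hr1 hr
      simp only
      rw [h2.reg _ (by omega), h1.reg r (.inr hr)]

theorem Tri.seq {π : Par} {c c' : Cmd} {σ : St} {Q : St → Prop}
    (h : Tri π c σ (fun τ => Tri π c' τ Q)) : Tri π (c ;; c') σ Q := by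
  intro hσ d s hd hs
  refine Ends.mono (Ends.seq (Ends.mono (h hσ d s hd hs) le_rfl
    fun s1 ⟨τ, h1, h2, h3, h4, h5⟩ => Ends.mono (h2 h1 d s1 hd h4) le_rfl
    fun s2 ⟨ρ, h6, h7, h8, h9, h10⟩ => ⟨ρ, h6, h7, h3.trans h8 ?_ ?_ ?_, h9,
      fun r hr hr' => (h10 r hr hr').trans (h5 r hr hr')⟩))
    (le_of_eq (by simp only [Cmd.cost]; ring)) fun _ h => h
  all_goals simp [Cmd.wv, Cmd.wa, Cmd.wi]

theorem Tri.ite {π : Par} {e : Ex} {c c' : Cmd} {σ : St} {Q : St → Prop} (he : e.Safe π σ)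
    (h : e.eval σ ≠ 0 → Tri π c σ Q) (h' : e.eval σ = 0 → Tri π c' σ Q) :
    Tri π (.ite e c c') σ Q := by
  intro hσ d s hd hs
  have h16 := two_pow_add_four π.L
  have hlte := Ex.eval_lt hσ he
  refine Ends.mono (Ends.seq (Ends.mono (e.ends hσ hd hs he) le_rfl fun s1 h1 =>
    Ends.ite (L := π.L) (t := c.cost π * stepCost π.L) (u := c'.cost π * stepCost π.L) ?_
      (fun h0 => ?_) (fun h0 => ?_)))
    (le_of_eq (by simp only [Cmd.cost]; ring)) fun _ h => h
  · rw [h1.val]; omega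
  · rw [h1.val] at h0
    refine Ends.mono (h h0 hσ d s1 hd (h1.rel hd hs)) le_rfl
      fun s2 ⟨τ, h2, h3, h4, h5, h6⟩ => ⟨τ, h2, h3, h4.mono ?_ ?_ ?_, h5,
        fun r hr hr' => (h6 r hr hr').trans (h1.reg r (.inr hr'))⟩
    all_goals simp +contextual [Cmd.wv, Cmd.wa, Cmd.wi]
  · rw [h1.val] at h0
    refine Ends.mono (h' h0 hσ d s1 hd (h1.rel hd hs)) le_rfl
      fun s2 ⟨τ, h2, h3, h4, h5, h6⟩ => ⟨τ, h2, h3, h4.mono ?_ ?_ ?_, h5,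
        fun r hr hr' => (h6 r hr hr').trans (h1.reg r (.inr hr'))⟩
    all_goals simp +contextual [Cmd.wv, Cmd.wa, Cmd.wi]

/-- The number of rounds is evaluated once, into a register that counts down while `x` counts up;
the body runs one level higher and cannot disturb that register. The `Frame` hypothesis handed to
`hstep` and `hQ` says that whatever the loop does not write keeps its initial value, so invariants
need only mention what changes. -/
theorem Tri.loop {π : Par} {big : Bool} {x : Var} {e : Ex} {c : Cmd} {σ : St} {Q : St → Prop}
    (I : ℕ → St → Prop) (he : e.Safe π σ) (hx : c.wv x = false) (hm : e.eval σ ≤ π.bound big)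
    (h0 : I 0 (σ.setV x 0))
    (hstep : ∀ i τ, i < e.eval σ → Frame (.loop big x e c) σ τ → τ.v x = i → I i τ →
      Tri π c τ (fun ρ => I (i + 1) (ρ.setV x (i + 1))))
    (hQ : ∀ τ, Frame (.loop big x e c) σ τ → τ.v x = e.eval σ → I (e.eval σ) τ → Q τ) :
    Tri π (.loop big x e c) σ Q := by
  intro hσ d s hd hs
  have h16 := two_pow_add_four π.L
  have hlte := Ex.eval_lt hσ he
  set m := e.eval σ with hmdef
  have hpos : 0 < 2 ^ π.L := by positivity
  let J : ℕ → State → Prop := fun i s' => s'.reg (2 * d + 1) = m - i ∧ ∃ τ, τ.Bdd π ∧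
    Frame (.loop big x e c) σ τ ∧ τ.v x = i ∧ I i τ ∧ Rel π τ s' ∧ Keep d s s'
  have hF : ∀ k τ, Frame (.loop big x e c) σ τ →
      Frame (.loop big x e c) σ (τ.setV x k) := by
    intro k τ hτ
    refine ⟨fun y hy => ?_, hτ.arr, hτ.inp⟩
    have : y ≠ x := by
      rintro rfl
      simp [Cmd.wv] at hy
    simp [this, hτ.v y hy]
  have hbody : ∀ i s', i < m → J i s' → Ends (.seq (c.comp (d + 1)) (.seq (.const (2 * d + 3) 1)
        (.seq (.arith .add (2 * x.idx) (2 * x.idx) (2 * d + 3))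
          (.arith .sub (2 * d + 1) (2 * d + 1) (2 * d + 3))))) s'
        (c.cost π * stepCost π.L + (stepCost π.L + (stepCost π.L + stepCost π.L)))
        (J (i + 1)) := by
    rintro i s' hi ⟨hr, τ, h1, h2, h3, h4, h5, h6⟩
    have hne : 2 * x.idx ≠ 2 * d + 1 := by omega
    have hne' : 2 * x.idx ≠ 2 * d + 3 := by omega
    have hnes : 2 * d + 1 ≠ 2 * x.idx := by omega
    have hnes' : 2 * d + 3 ≠ 2 * x.idx := by omega
    refine Ends.seq (Ends.mono (hstep i τ hi h2 h3 h4 h1 (d + 1) s' (by omega) h5) le_rfl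
      fun s1 ⟨ρ, h7, h8, h9, h10, h11⟩ => Ends.seq (Ends.const (L := π.L) (by omega)
        (Ends.seq (Ends.arith (L := π.L) ?_ ?_ (Ends.arith (L := π.L) ?_ ?_ ⟨?_, ?_⟩)))))
    all_goals
      have hrx : s1.reg (2 * x.idx) = i := by rw [h10.v, h9.v x hx, h3]
      have hrd : s1.reg (2 * d + 1) = m - i := by
        rw [h11 _ (by omega) (by omega), hr]
    · simp [hne', hrx]; omega
    · simp
    · simp [hnes, hrd]; omega
    · simp [hnes']
    · simp [hnes, hnes', hrd, Op.eval]; omega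
    · refine ⟨ρ.setV x (i + 1), h7.setV x (by omega), ?_, by simp, h8, ?_, ?_⟩
      · refine hF _ _ (h2.trans h9 ?_ ?_ ?_) <;> simp +contextual [Cmd.wv, Cmd.wa, Cmd.wi]
      · have := ((h10.temp (r := 2 * d + 3) (by omega) (by omega) 1).setV x (i + 1)).temp
          (r := 2 * d + 1) (by omega) (by omega) (m - (i + 1))
        simpa [hrx, hrd, Op.eval, mul_add, hnes, hnes', hne', Nat.sub_sub] using this
      · intro r hr1 hr2
        have a1 : r ≠ 2 * d + 1 := by omega
        have a2 : r ≠ 2 * d + 3 := by omega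
        have a3 : r ≠ 2 * x.idx := by omega
        simp [a1, a2, a3]
        rw [h11 r hr1 (by omega), h6 r hr1 hr2]
  refine Ends.mono (Ends.seq (Ends.mono (e.ends hσ hd hs he) le_rfl fun s1 h1 =>
    Ends.seq (Ends.const (L := π.L) (by omega) (Ends.mono (Ends.loop (L := π.L) (m := m) J
      (by omega) (fun i s' h => h.1) hbody ?_) (t' := stepCost π.L + π.bound big *
        ((c.cost π + 4) * stepCost π.L)) ?_ fun s' h => ?_)))) ?_ fun s' h => h
  · refine ⟨?_, σ.setV x 0, hσ.setV x hpos, hF _ _ (Frame.refl _ _), by simp, h0,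
      (h1.rel hd hs).setV x 0, ?_⟩
    · have : 2 * d + 1 ≠ 2 * x.idx := by omega
      simp [this, h1.val, hmdef]
    · intro r hr1 hr2
      have a3 : r ≠ 2 * x.idx := by omega
      simp [a3, h1.reg r (.inr hr2)]
  · calc _ = stepCost π.L + m * ((c.cost π + 4) * stepCost π.L) := by ring
      _ ≤ _ := by gcongr
  · obtain ⟨hr, τ, h1, h2, h3, h4, h5, h6⟩ := h
    exact ⟨τ, h1, hQ τ h2 h3 h4, h2, h5, h6⟩
  · exact le_of_eq (by simp only [Cmd.cost]; ring)

/-! ### Asymptotic cost -/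

/-- Nesting depth of the ordinary (`b = false`) or big loops. -/
def Cmd.depth (b : Bool) : Cmd → ℕ
  | .seq c c' => max (c.depth b) (c'.depth b)
  | .ite _ c c' => max (c.depth b) (c'.depth b)
  | .loop big _ _ c => (if big = b then 1 else 0) + c.depth b
  | _ => 0

/-- The constant factor in the cost bound. -/
def Cmd.size : Cmd → ℕ
  | .skip => 1
  | .assign _ e => e.cost + 2
  | .store _ i e => i.cost + e.cost + 6
  | .out i e => i.cost + e.cost + 1
  | .seq c c' => c.size + c'.size
  | .ite e c c' => e.cost + 1 + c.size + c'.size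
  | .loop _ _ e c => e.cost + 2 + c.size + 4

/-- Composition adds costs and nesting multiplies them, so the bounds `π.p` and `π.g` occur with the
nesting depths of the two kinds of loops as exponents. -/
theorem Cmd.cost_le {π : Par} (hp : 1 ≤ π.p) (hg : 1 ≤ π.g) (c : Cmd) :
    c.cost π ≤ c.size * π.p ^ c.depth false * π.g ^ c.depth true := by
  have one : ∀ a b, 1 ≤ π.p ^ a * π.g ^ b := fun a b =>
    Nat.one_le_iff_ne_zero.2 (by positivity)
  have mono : ∀ {a a' b b'}, a ≤ a' → b ≤ b' → π.p ^ a * π.g ^ b ≤ π.p ^ a' * π.g ^ b' :=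
    fun h h' => Nat.mul_le_mul (Nat.pow_le_pow_right hp h) (Nat.pow_le_pow_right hg h')
  simp only [mul_assoc]
  induction c with
  | skip | assign | store | out => simp [cost, size, depth]
  | seq c c' ih ih' =>
    simp only [cost, size, depth, add_mul]
    exact Nat.add_le_add (ih.trans (Nat.mul_le_mul le_rfl (mono (le_max_left _ _) (le_max_left _ _))))
      (ih'.trans (Nat.mul_le_mul le_rfl (mono (le_max_right _ _) (le_max_right _ _))))
  | ite e c c' ih ih' =>
    simp only [cost, size, depth, add_mul]
    refine Nat.add_le_add (Nat.add_le_add ?_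
      (ih.trans (Nat.mul_le_mul le_rfl (mono (le_max_left _ _) (le_max_left _ _)))))
      (ih'.trans (Nat.mul_le_mul le_rfl (mono (le_max_right _ _) (le_max_right _ _))))
    rw [← add_mul]
    exact Nat.le_mul_of_pos_right _ (one _ _)
  | loop big x e c ih =>
    simp only [cost, size, depth]
    have h1 : π.bound big * (π.p ^ c.depth false * π.g ^ c.depth true) =
        π.p ^ ((if big = false then 1 else 0) + c.depth false) *
          π.g ^ ((if big = true then 1 else 0) + c.depth true) := by
      cases big <;> simp [Par.bound] <;> ring
    have h2 := one ((if big = false then 1 else 0) + c.depth false)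
      ((if big = true then 1 else 0) + c.depth true)
    rw [← h1] at h2 ⊢
    set D := π.p ^ c.depth false * π.g ^ c.depth true
    have h3 : 1 ≤ D := one _ _
    calc e.cost + 2 + π.bound big * (c.cost π + 4)
        ≤ (e.cost + 2) * (π.bound big * D) + π.bound big * (c.size * D + 4 * D) := by
          gcongr
          · exact Nat.le_mul_of_pos_right _ h2
          · omega
      _ = _ := by ring

end ForLang

/-! ## Branching walks -/

namespace BranchingWalk

open Finset

/-- The number of branching walks with `s + 1` nodes, with root `v` and with support `U`. A
branching walk is a homomorphic image of an ordered rooted tree; it is either a single node, or its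
first branch together with the rest. -/
def cov {V : Type*} [Fintype V] [DecidableEq V] (G : SimpleGraph V) [DecidableRel G.Adj] :
    ℕ → V → Finset V → ℕ
  | 0, v, U => if U = {v} then 1 else 0
  | s + 1, v, U => ∑ t : Fin (s + 1), ∑ u, if G.Adj v u then
      ∑ p : Finset V × Finset V, if p.1 ∪ p.2 = U then cov G t u p.1 * cov G (s - t) v p.2 else 0
      else 0
termination_by s => s

/-- A path inside `H` from a vertex of `K` to one outside has to cross the boundary of `K` along
some edge. -/
theorem exists_adj_of_preconnected {V : Type*} {G : SimpleGraph V} {H : Finset V} (hH : (G.induce (H : Set V)).Preconnected)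
    {K : Finset V} (hK : K.Nonempty) (hKH : K ⊆ H) (hne : ∃ b ∈ H, b ∉ K) :
    ∃ a ∈ K, ∃ b ∈ H, b ∉ K ∧ G.Adj a b := by
  obtain ⟨a, ha⟩ := hK
  obtain ⟨b, hb, hbK⟩ := hne
  obtain ⟨p⟩ := hH ⟨a, hKH ha⟩ ⟨b, hb⟩
  obtain ⟨d, -, h1, h2⟩ := p.exists_boundary_dart {x | (x : V) ∈ K} ha hbK
  exact ⟨d.fst, h1, d.snd, d.snd.2, h2, d.adj⟩

section

variable {V : Type*} [Fintype V] [DecidableEq V] (G : SimpleGraph V) [DecidableRel G.Adj]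

theorem cov_zero_ne_zero {v : V} {U : Finset V} : cov G 0 v U ≠ 0 ↔ U = {v} := by
  rw [cov]; simp

/-- Nothing cancels in a sum of natural numbers, so a nonzero count means that a walk exists. The
facts about supports below use only this form of the recursion. -/
theorem cov_succ_ne_zero {s : ℕ} {v : V} {U : Finset V} :
    cov G (s + 1) v U ≠ 0 ↔ ∃ t ≤ s, ∃ u, G.Adj v u ∧ ∃ U₁ U₂, U₁ ∪ U₂ = U ∧
      cov G t u U₁ ≠ 0 ∧ cov G (s - t) v U₂ ≠ 0 := by
  rw [cov]
  simp only [ne_eq, Finset.sum_eq_zero_iff, Finset.mem_univ, true_imp_iff, not_forall,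
    ite_eq_right_iff, exists_prop, Prod.exists, mul_eq_zero, not_or]
  constructor
  · rintro ⟨t, u, hu, U₁, U₂, h⟩
    exact ⟨t, by omega, u, hu, U₁, U₂, h⟩
  · rintro ⟨t, ht, u, hu, U₁, U₂, h⟩
    exact ⟨⟨t, by omega⟩, u, hu, U₁, U₂, h⟩

variable {G}

theorem mem_of_cov {s : ℕ} : ∀ {v : V} {U : Finset V}, cov G s v U ≠ 0 → v ∈ U := by
  induction s using Nat.strong_induction_on with
  | _ s ih =>
    intro v U h
    cases s with
    | zero =>
      rw [cov_zero_ne_zero] at h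
      simp [h]
    | succ s =>
      obtain ⟨t, ht, u, hu, U₁, U₂, rfl, -, h2⟩ := (cov_succ_ne_zero G).1 h
      exact mem_union_right _ (ih (s - t) (by omega) h2)

theorem card_le_of_cov {s : ℕ} : ∀ {v : V} {U : Finset V}, cov G s v U ≠ 0 → U.card ≤ s + 1 := by
  induction s using Nat.strong_induction_on with
  | _ s ih =>
    intro v U h
    cases s with
    | zero =>
      rw [cov_zero_ne_zero] at h
      simp [h]
    | succ s =>
      obtain ⟨t, ht, u, hu, U₁, U₂, rfl, h1, h2⟩ := (cov_succ_ne_zero G).1 h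
      have a := ih t (by omega) h1
      have b := ih (s - t) (by omega) h2
      have c := card_union_le U₁ U₂
      omega

/-- The supports of the first branch and of the rest are connected by induction, and the edge
between their roots joins them. -/
theorem preconnected_of_cov {s : ℕ} : ∀ {v : V} {U : Finset V}, cov G s v U ≠ 0 →
    (G.induce (U : Set V)).Preconnected := by
  induction s using Nat.strong_induction_on with
  | _ s ih =>
    intro v U h
    cases s with
    | zero =>
      rw [cov_zero_ne_zero] at h
      subst h
      rintro ⟨a, ha⟩ ⟨b, hb⟩
      simp only [coe_singleton, Set.mem_singleton_iff] at ha hb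
      subst ha hb
      rfl
    | succ s =>
      obtain ⟨t, ht, u, hu, U₁, U₂, rfl, h1, h2⟩ := (cov_succ_ne_zero G).1 h
      rw [coe_union]
      exact (SimpleGraph.connected_induce_union (ih t (by omega) h1) (ih (s - t) (by omega) h2)
        (mem_of_cov h1) (mem_of_cov h2) hu.symm).preconnected

/-- A new leaf at `x` is hung below a node that sits at `w`. The induction descends into the part
whose support contains `w` until that part is a single node. -/
theorem cov_insert {s : ℕ} : ∀ {v : V} {U : Finset V}, cov G s v U ≠ 0 → ∀ {w x : V}, w ∈ U →
    G.Adj w x → cov G (s + 1) v (insert x U) ≠ 0 := by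
  induction s using Nat.strong_induction_on with
  | _ s ih =>
    intro v U h w x hw hx
    rw [cov_succ_ne_zero]
    cases s with
    | zero =>
      have h' := (cov_zero_ne_zero G).1 h
      subst h'
      obtain rfl : w = v := by simpa using hw
      exact ⟨0, le_rfl, x, hx, {x}, {w}, by ext; simp, (cov_zero_ne_zero G).2 rfl, h⟩
    | succ s =>
      obtain ⟨t, ht, u, hu, U₁, U₂, rfl, h1, h2⟩ := (cov_succ_ne_zero G).1 h
      rcases mem_union.1 hw with hw | hw
      · refine ⟨t + 1, by omega, u, hu, insert x U₁, U₂, by simp, ih t (by omega) h1 hw hx, ?_⟩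
        rwa [show s + 1 - (t + 1) = s - t by omega]
      · refine ⟨t, by omega, u, hu, U₁, insert x U₂, by simp, h1, ?_⟩
        rw [show s + 1 - t = (s - t) + 1 by omega]
        exact ih (s - t) (by omega) h2 hw hx

/-- A spanning tree of `H` rooted at `v`, grown leaf by leaf: every new node visits a new vertex, so
`H.card` nodes suffice, and the index is one less than the number of nodes. -/
theorem exists_cov {H : Finset V} (hH : (G.induce (H : Set V)).Preconnected) {v : V} (hv : v ∈ H) :
    cov G (H.card - 1) v H ≠ 0 := by
  have key : ∀ m, m + 1 ≤ H.card → ∃ U ⊆ H, U.card = m + 1 ∧ cov G m v U ≠ 0 := by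
    intro m
    induction m with
    | zero => exact fun _ => ⟨{v}, by simpa using hv, by simp, (cov_zero_ne_zero G).2 rfl⟩
    | succ m ih =>
      intro hm
      obtain ⟨U, hU, hc, h⟩ := ih (by omega)
      obtain ⟨b, hb, hbU⟩ := exists_mem_notMem_of_card_lt_card (s := U) (t := H) (by omega)
      obtain ⟨a, ha, b, hb, hbU, hab⟩ :=
        exists_adj_of_preconnected hH ⟨v, mem_of_cov h⟩ hU ⟨b, hb, hbU⟩
      exact ⟨insert b U, insert_subset hb hU, by rw [card_insert_of_notMem hbU, hc],
        cov_insert h ha hab⟩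
  have hpos : 0 < H.card := card_pos.2 ⟨v, hv⟩
  obtain ⟨U, hU, hc, h⟩ := key (H.card - 1) (by omega)
  rwa [eq_of_subset_of_card_le hU (by omega)] at h

/-! ### Walks that visit a prescribed set -/

variable (G)

/-- The number of branching walks with `s + 1` nodes that stay inside `A` and visit all of `C`. -/
def covCount (s : ℕ) (A C : Finset V) : ℕ :=
  ∑ v, ∑ U ∈ A.powerset with C ⊆ U, cov G s v U

theorem covCount_ne_zero {s : ℕ} {A C : Finset V} :
    covCount G s A C ≠ 0 ↔ ∃ v U, U ⊆ A ∧ C ⊆ U ∧ cov G s v U ≠ 0 := by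
  simp [covCount]

/-- One step of inclusion-exclusion: a walk inside `A` that visits `C` either visits `i` or stays
inside `A.erase i`. The truncated subtraction is exact, since the second family is part of the
first. -/
theorem covCount_insert {s : ℕ} {A C : Finset V} {i : V} :
    covCount G s A (insert i C) = covCount G s A C - covCount G s (A.erase i) C := by
  rw [eq_comm, Nat.sub_eq_iff_eq_add', covCount, covCount, covCount, ← sum_add_distrib]
  · refine sum_congr rfl fun v _ => ?_
    rw [← sum_union]
    · refine sum_congr ?_ fun _ _ => rfl
      ext U
      simp only [mem_filter, mem_powerset, mem_union, insert_subset_iff, subset_erase]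
      tauto
    · rw [disjoint_left]
      intro U hU hU'
      simp only [mem_filter, mem_powerset, insert_subset_iff, subset_erase] at hU hU'
      tauto
  · refine sum_le_sum fun v _ => sum_le_sum_of_subset fun U => ?_
    simp only [mem_filter, mem_powerset, subset_erase]
    tauto

end

/-! ### Counting walks inside a set by recursion -/

/-- The number of branching walks with `s + 1` nodes and root `v` in a graph with vertices
`0, …, n - 1`, in terms of its adjacency matrix `e` and of the indicator `a` of the vertices that
may be used. -/
def walkCount (n : ℕ) (e : ℕ → ℕ → ℕ) (a : ℕ → ℕ) : ℕ → ℕ → ℕ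
  | 0, v => a v
  | s + 1, v => ∑ t : Fin (s + 1), ∑ u ∈ range n,
      e v u * walkCount n e a t u * walkCount n e a (s - t) v
termination_by s => s

theorem walkCount_zero {n : ℕ} {e : ℕ → ℕ → ℕ} {a : ℕ → ℕ} {v : ℕ} : walkCount n e a 0 v = a v := by
  rw [walkCount]

theorem walkCount_succ {n : ℕ} {e : ℕ → ℕ → ℕ} {a : ℕ → ℕ} {s v : ℕ} :
    walkCount n e a (s + 1) v = ∑ t ∈ range (s + 1), ∑ u ∈ range n,
      e v u * walkCount n e a t u * walkCount n e a (s - t) v := by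
  rw [walkCount, Finset.sum_range]

/-- A union lies in `A` exactly when both parts do, so the union product turns into an ordinary
product once it is summed over the subsets of `A`. Supports thereby drop out of the recursion, and a
table of polynomial size is enough. -/
theorem sum_union_product {V : Type*} [Fintype V] [DecidableEq V] (f g : Finset V → ℕ)
    (A : Finset V) :
    ∑ U ∈ A.powerset, ∑ p : Finset V × Finset V, (if p.1 ∪ p.2 = U then f p.1 * g p.2 else 0) =
      (∑ U ∈ A.powerset, f U) * ∑ U ∈ A.powerset, g U := by
  have hA : A.powerset = univ.filter (· ⊆ A) := by ext; simp
  rw [sum_comm, sum_mul_sum, Fintype.sum_prod_type]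
  simp only [Finset.sum_ite_eq, mem_powerset, union_subset_iff]
  simp only [hA, sum_filter]
  refine sum_congr rfl fun U _ => ?_
  by_cases h : U ⊆ A <;> simp [h]

theorem sum_cov {n : ℕ} (G : SimpleGraph (Fin n)) [DecidableRel G.Adj] {e : ℕ → ℕ → ℕ} {a : ℕ → ℕ}
    {A : Finset (Fin n)} (he : ∀ i j : Fin n, e i j = if G.Adj i j then 1 else 0)
    (ha : ∀ v : Fin n, a v = if v ∈ A then 1 else 0) (s : ℕ) :
    ∀ v : Fin n, ∑ U ∈ A.powerset, cov G s v U = walkCount n e a s v := by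
  induction s using Nat.strong_induction_on with
  | _ s ih =>
    intro v
    cases s with
    | zero =>
      simp [cov, walkCount_zero, ha]
    | succ s =>
      rw [walkCount]
      simp only [cov]
      rw [sum_comm]
      refine sum_congr rfl fun t _ => ?_
      rw [sum_comm, Finset.sum_range]
      refine sum_congr rfl fun u _ => ?_
      rw [he]
      by_cases h : G.Adj v u
      · simp only [h, if_true, one_mul]
        rw [sum_union_product, ih t (by omega), ih (s - t) (by omega)]
      · simp [h]

theorem covCount_empty {n : ℕ} (G : SimpleGraph (Fin n)) [DecidableRel G.Adj] {e : ℕ → ℕ → ℕ}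
    {a : ℕ → ℕ} {A : Finset (Fin n)} (he : ∀ i j : Fin n, e i j = if G.Adj i j then 1 else 0)
    (ha : ∀ v : Fin n, a v = if v ∈ A then 1 else 0) (s : ℕ) :
    ∑ v ∈ range n, walkCount n e a s v = covCount G s A ∅ := by
  simp [covCount, sum_cov G he ha, Finset.sum_range]

/-- Only the polynomial bit length matters. An exponent quadratic in `s` is convenient: `t ^ 2 + (s
- t) ^ 2 ≤ s ^ 2` absorbs the product of the two parts, and the growth from `s ^ 2` to `(s + 1) ^ 2`
absorbs the number `(s + 1) * n` of summands. -/
theorem walkCount_le {n : ℕ} {e : ℕ → ℕ → ℕ} {a : ℕ → ℕ} (he : ∀ i < n, ∀ j < n, e i j ≤ 1)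
    (ha : ∀ v < n, a v ≤ 1) (s : ℕ) :
    ∀ v < n, walkCount n e a s v ≤ 2 ^ ((n + 1) * s ^ 2) := by
  induction s using Nat.strong_induction_on with
  | _ s ih =>
    intro v hv
    cases s with
    | zero => simpa [walkCount_zero] using ha v hv
    | succ s =>
      rw [walkCount_succ]
      calc _ ≤ ∑ t ∈ range (s + 1), ∑ u ∈ range n, 2 ^ ((n + 1) * s ^ 2) := by
            refine sum_le_sum fun t ht => sum_le_sum fun u hu => ?_
            rw [mem_range] at ht hu
            have h1 := ih t (by omega) u hu
            have h2 := ih (s - t) (by omega) v hv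
            have h3 : t ^ 2 + (s - t) ^ 2 ≤ s ^ 2 := by
              obtain ⟨r, rfl⟩ := Nat.exists_eq_add_of_le (show t ≤ s by omega)
              simp only [add_tsub_cancel_left]
              nlinarith [Nat.zero_le (t * r)]
            calc _ ≤ 1 * 2 ^ ((n + 1) * t ^ 2) * 2 ^ ((n + 1) * (s - t) ^ 2) := by
                  gcongr
                  exact he v hv u hu
              _ = 2 ^ ((n + 1) * (t ^ 2 + (s - t) ^ 2)) := by rw [one_mul, ← pow_add, mul_add]
              _ ≤ _ := by gcongr; omega
        _ = (s + 1) * n * 2 ^ ((n + 1) * s ^ 2) := by simp [mul_assoc]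
        _ ≤ 2 ^ s * 2 ^ n * 2 ^ ((n + 1) * s ^ 2) := by
            gcongr
            · exact Nat.lt_two_pow_self
            · exact Nat.lt_two_pow_self.le
        _ = 2 ^ (s + n + (n + 1) * s ^ 2) := by ring
        _ ≤ _ := by
            gcongr
            · omega
            · nlinarith [Nat.zero_le (n * s)]

end BranchingWalk

/-! ## Balanced connected sets -/

namespace BCS

open Finset BranchingWalk

variable {V : Type*} [DecidableEq V]

/-- Inside `S` there is a connected set with `k` vertices in `M` and `k` vertices outside. -/
def Feasible (G : SimpleGraph V) (M S : Finset V) (k : ℕ) : Prop :=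
  ∃ H ⊆ S, (H ∩ M).card = k ∧ (H \ M).card = k ∧ (G.induce (H : Set V)).Preconnected

theorem Feasible.mono {G : SimpleGraph V} {M S S' : Finset V} {k : ℕ} (h : Feasible G M S k)
    (hS : S ⊆ S') : Feasible G M S' k := by
  obtain ⟨H, h1, h2⟩ := h
  exact ⟨H, h1.trans hS, h2⟩

theorem feasible_zero (G : SimpleGraph V) (M S : Finset V) : Feasible G M S 0 :=
  ⟨∅, by simp, by simp, by simp, fun a => absurd a.2 (by simp)⟩

/-! ### Reachable vertices and the criterion for a trace -/

/-- `Q` consists of the vertices that can be reached from `Y` through `A`. -/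
structure IsClosure (G : SimpleGraph V) (A Y Q : Finset V) : Prop where
  subset : Y ⊆ Q
  closed : ∀ i ∈ A, ∀ j ∈ Q, G.Adj i j → i ∈ Q
  least : ∀ Z : Finset V, Y ⊆ Z → (∀ i ∈ A, ∀ j ∈ Z, G.Adj i j → i ∈ Z) → Q ⊆ Z

/-- Grow a connected set, vertex by vertex, to `k` vertices outside `M`. -/
theorem exists_extension {G : SimpleGraph V} {M A Y Q : Finset V} {k : ℕ}
    (hQ : IsClosure G A Y Q) (hA : A ∩ M ⊆ Y) (hk : k ≤ (Q \ M).card) (m : ℕ) :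
    ∀ H : Finset V, Y ⊆ H → H ⊆ A → (H \ M).card + m = k → (G.induce (H : Set V)).Preconnected →
      ∃ H', Y ⊆ H' ∧ H' ⊆ A ∧ (H' \ M).card = k ∧ (G.induce (H' : Set V)).Preconnected := by
  induction m with
  | zero => exact fun H h1 h2 h3 h4 => ⟨H, h1, h2, h3, h4⟩
  | succ m ih =>
    intro H h1 h2 h3 h4
    -- `H` still has fewer than `k` vertices outside `M`, while `Q` has at least `k`. By leastness
    -- of `Q`, the set `H` is therefore not closed and has a new neighbor within `A`.
    have hnot : ¬ Q ⊆ H := fun h => by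
      have := card_le_card (sdiff_subset_sdiff h (Subset.refl M))
      omega
    obtain ⟨i, hi, j, hj, hij, hiH⟩ : ∃ i ∈ A, ∃ j ∈ H, G.Adj i j ∧ i ∉ H := by
      by_contra hcon
      push Not at hcon
      exact hnot (hQ.least H h1 hcon)
    -- All vertices of `A ∩ M` are already in `Y`, so growing never changes the trace on `M`.
    have hiM : i ∉ M := fun h => hiH (h1 (hA (mem_inter.2 ⟨hi, h⟩)))
    refine ih (insert i H) (h1.trans (subset_insert _ _)) (insert_subset hi h2) ?_ ?_
    · rw [insert_sdiff_of_notMem _ hiM, card_insert_of_notMem (by simp [hiH])]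
      omega
    · rw [insert_eq, coe_union]
      refine (SimpleGraph.connected_induce_union (v := i) (w := j) ?_ h4 (by simp) hj hij).preconnected
      rintro ⟨a, ha⟩ ⟨b, hb⟩
      simp only [coe_singleton, Set.mem_singleton_iff] at ha hb
      subst ha hb
      rfl

variable [Fintype V]

/-- The vertices that may be used by a set whose intersection with `M` is `Y`. -/
def allowed (M S Y : Finset V) : Finset V := (Y ∪ Mᶜ) ∩ S

theorem allowed_inter {M S Y : Finset V} : allowed M S Y ∩ M ⊆ Y := by
  intro v
  simp only [allowed, mem_inter, mem_union, mem_compl]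
  tauto

/-- A walk with `2 * k` nodes has at most `2 * k` vertices. Its support meets `M` exactly in the `k`
vertices of `Y`, which leaves at most `k` outside; missing ones are supplied by `exists_extension`.
-/
theorem feasible_of_covCount {G : SimpleGraph V} [DecidableRel G.Adj] {M S Y Q : Finset V} {k : ℕ}
    (hk : 1 ≤ k) (hYM : Y ⊆ M) (hY : Y.card = k)
    (hcov : covCount G (2 * k - 1) (allowed M S Y) Y ≠ 0)
    (hQ : IsClosure G (allowed M S Y) Y Q) (hQk : k ≤ (Q \ M).card) : Feasible G M S k := by
  obtain ⟨v, U, hUA, hYU, hU⟩ := (covCount_ne_zero G).1 hcov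
  have inter : ∀ H, Y ⊆ H → H ⊆ allowed M S Y → H ∩ M = Y := fun H h1 h2 =>
    Subset.antisymm ((inter_subset_inter h2 (Subset.refl M)).trans allowed_inter)
      (subset_inter h1 hYM)
  have hcard := card_le_of_cov hU
  have hsum := card_inter_add_card_sdiff U M
  rw [inter U hYU hUA] at hsum
  obtain ⟨H, h1, h2, h3, h4⟩ := exists_extension hQ allowed_inter hQk (k - (U \ M).card) U hYU hUA
    (by omega) (preconnected_of_cov hU)
  exact ⟨H, h2.trans inter_subset_right, by rw [inter H h1 h2, hY], h3, h4⟩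

/-- Take `Y = H ∩ M` and a spanning tree of `H`. The reachable set contains `H`, since otherwise
connectedness would give an edge from `H ∩ Q` to the rest of `H`, against closedness. -/
theorem covCount_of_feasible {G : SimpleGraph V} [DecidableRel G.Adj] {M S : Finset V} {k : ℕ}
    (hk : 1 ≤ k) (h : Feasible G M S k) : ∃ Y ⊆ M, Y.card = k ∧
      covCount G (2 * k - 1) (allowed M S Y) Y ≠ 0 ∧
      ∀ Q, IsClosure G (allowed M S Y) Y Q → k ≤ (Q \ M).card := by
  obtain ⟨H, hS, h1, h2, h3⟩ := h
  have hHA : H ⊆ allowed M S (H ∩ M) := by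
    intro v hv
    have := hS hv
    simp only [allowed, mem_inter, mem_union, mem_compl]
    tauto
  have hsum := card_inter_add_card_sdiff H M
  have hne : (H ∩ M).Nonempty := card_pos.1 (by omega)
  obtain ⟨v, hv⟩ := hne
  refine ⟨H ∩ M, inter_subset_right, h1, (covCount_ne_zero G).2
    ⟨v, H, hHA, inter_subset_left, ?_⟩, fun Q hQ => ?_⟩
  · rw [show 2 * k - 1 = H.card - 1 by omega]
    exact exists_cov h3 (mem_inter.1 hv).1
  · rw [← h2]
    refine card_le_card (sdiff_subset_sdiff ?_ (Subset.refl M))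
    intro b hb
    by_contra hbQ
    obtain ⟨x, hx, y, hy, hyn, hxy⟩ := exists_adj_of_preconnected h3 (K := H ∩ Q)
      ⟨v, mem_inter.2 ⟨(mem_inter.1 hv).1, hQ.subset hv⟩⟩ inter_subset_left
      ⟨b, hb, fun h => hbQ (mem_inter.1 h).2⟩
    exact hyn (mem_inter.2 ⟨hy, hQ.closed y (hHA hy) x (mem_inter.1 hx).2 hxy.symm⟩)

/-- One round of growing: the new set contains all neighbors within `A`, and nothing that a closed
set would not contain. -/
structure Grows {V : Type*} (G : SimpleGraph V) (A Q Q' : Finset V) : Prop where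
  subset : Q ⊆ Q'
  neighbors : ∀ i ∈ A, ∀ j ∈ Q, G.Adj i j → i ∈ Q'
  least : ∀ Z : Finset V, Q ⊆ Z → (∀ i ∈ A, ∀ j ∈ Z, G.Adj i j → i ∈ Z) → Q' ⊆ Z

/-- What is known after `r` rounds of growing. -/
structure IsPartialClosure {V : Type*} (G : SimpleGraph V) (A Y : Finset V) (r : ℕ) (Q : Finset V) : Prop where
  subset : Y ⊆ Q
  progress : (∀ i ∈ A, ∀ j ∈ Q, G.Adj i j → i ∈ Q) ∨ r ≤ Q.card
  least : ∀ Z : Finset V, Y ⊆ Z → (∀ i ∈ A, ∀ j ∈ Z, G.Adj i j → i ∈ Z) → Q ⊆ Z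

theorem isPartialClosure_zero {V : Type*} (G : SimpleGraph V) (A Y : Finset V) :
    IsPartialClosure G A Y 0 Y :=
  ⟨Subset.refl _, .inr (Nat.zero_le _), fun _ h _ => h⟩

/-- A round started from a closed set changes nothing; a round started from any other set adds a
vertex. -/
theorem IsPartialClosure.succ {V : Type*} {G : SimpleGraph V} {A Y Q Q' : Finset V} {r : ℕ}
    (h : IsPartialClosure G A Y r Q) (h' : Grows G A Q Q') :
    IsPartialClosure G A Y (r + 1) Q' := by
  refine ⟨h.subset.trans h'.subset, ?_, fun Z h1 h2 => h'.least Z (h.least Z h1 h2) h2⟩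
  by_cases hQ : ∀ i ∈ A, ∀ j ∈ Q, G.Adj i j → i ∈ Q
  · rw [← Subset.antisymm h'.subset (h'.least Q (Subset.refl _) hQ)]
    exact .inl hQ
  · right
    have hr : r ≤ Q.card := h.progress.resolve_left hQ
    push Not at hQ
    obtain ⟨i, hi, j, hj, hij, hiQ⟩ := hQ
    have : Q ⊂ Q' := ⟨h'.subset, fun hc => hiQ (hc (h'.neighbors i hi j hj hij))⟩
    have := card_lt_card this
    omega

/-- If every round made progress, then by now all vertices are present, and the full vertex set is
closed. -/
theorem IsPartialClosure.isClosure {V : Type*} [Fintype V] {G : SimpleGraph V} {A Y Q : Finset V} {r : ℕ}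
    (h : IsPartialClosure G A Y r Q) (hr : Fintype.card V ≤ r) : IsClosure G A Y Q := by
  refine ⟨h.subset, ?_, h.least⟩
  rcases h.progress with h1 | h1
  · exact h1
  · have : Q = univ := by
      rw [← card_eq_iff_eq_univ]
      exact le_antisymm (card_le_univ _) (hr.trans h1)
    simp [this]

/-! ### Sets of vertices as bit masks -/

/-- The number of members of `M` below `v`. -/
def rank {n : ℕ} (M : Finset (Fin n)) (v : ℕ) : ℕ := (M.filter fun w : Fin n => (w : ℕ) < v).card

/-- The weight of a vertex in a bit mask; the vertices outside `M` have weight `0`. -/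
def weight {n : ℕ} (M : Finset (Fin n)) (v : ℕ) : ℕ :=
  if ∃ w ∈ M, (w : ℕ) = v then 2 ^ rank M v else 0

/-- The set with bit mask `X`, where vertex `v` has weight `p v`. -/
def decode {n : ℕ} (p : ℕ → ℕ) (X : ℕ) : Finset (Fin n) := {v | X / p v % 2 = 1}

section

variable {n : ℕ} {M : Finset (Fin n)}

theorem mem_decode {p : ℕ → ℕ} {X : ℕ} {v : Fin n} : v ∈ decode p X ↔ X / p v % 2 = 1 := by
  simp [decode]

theorem weight_of_mem {v : Fin n} (h : v ∈ M) : weight M v = 2 ^ rank M v :=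
  if_pos ⟨v, h, rfl⟩

theorem weight_of_notMem {v : Fin n} (h : v ∉ M) : weight M v = 0 :=
  if_neg fun ⟨w, hw, hwv⟩ => h (by rwa [Fin.ext hwv] at hw)

theorem weight_ne_zero {v : Fin n} : weight M v ≠ 0 ↔ v ∈ M := by
  by_cases h : v ∈ M <;> simp [weight_of_mem, weight_of_notMem, h]

theorem rank_mono {v w : ℕ} (h : v ≤ w) : rank M v ≤ rank M w :=
  card_le_card fun x hx => by
    simp only [mem_filter] at hx ⊢
    exact ⟨hx.1, hx.2.trans_le h⟩

theorem rank_succ_of_mem {v : Fin n} (h : v ∈ M) : rank M (v + 1) = rank M v + 1 := by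
  have : (M.filter fun w : Fin n => (w : ℕ) < v + 1) = insert v (M.filter fun w : Fin n => (w : ℕ) < v) := by
    ext w
    simp only [mem_filter, mem_insert, Fin.ext_iff]
    constructor
    · rintro ⟨a, b⟩
      by_cases hw : (w : ℕ) = v
      · exact .inl hw
      · exact .inr ⟨a, by omega⟩
    · rintro (a | a)
      · exact ⟨by rwa [Fin.ext a], by omega⟩
      · exact ⟨a.1, by omega⟩
  rw [rank, this, card_insert_of_notMem (by simp), rank]

theorem rank_succ_of_notMem {v : Fin n} (h : v ∉ M) : rank M (v + 1) = rank M v := by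
  unfold rank
  congr 1
  ext w
  simp only [mem_filter, and_congr_right_iff]
  intro hw
  have : (w : ℕ) ≠ v := fun hc => h (by rwa [Fin.ext hc] at hw)
  omega

theorem rank_lt {v w : Fin n} (hv : v ∈ M) (h : v < w) : rank M v < rank M w := by
  have h1 := rank_succ_of_mem hv
  have h2 : rank M (v + 1) ≤ rank M w := rank_mono h
  omega

theorem rank_zero : rank M 0 = 0 := by simp [rank]

theorem rank_self : rank M n = M.card := by
  unfold rank
  congr 1
  ext w
  simp

/-- Weight `0` works as "not in `M`" because `X / 0 = 0` is even: such a vertex never belongs to a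
mask. -/
theorem decode_weight_subset {X : ℕ} : decode (weight M) X ⊆ M := by
  intro v hv
  rw [mem_decode] at hv
  rw [← weight_ne_zero]
  intro h
  simp [h] at hv

theorem exists_decode_weight {Y : Finset (Fin n)} (hY : Y ⊆ M) :
    ∃ X < 2 ^ M.card, decode (weight M) X = Y := by
  -- The mask is built from its low bits: the members of `M` below `m` use the first `rank M m` of
  -- them.
  have key : ∀ m ≤ n, ∃ X < 2 ^ rank M m, ∀ v : Fin n, (v : ℕ) < m → v ∈ M →
      (X / 2 ^ rank M v % 2 = 1 ↔ v ∈ Y) := by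
    intro m
    induction m with
    | zero => exact fun _ => ⟨0, by simp [rank_zero], fun v hv => absurd hv (by omega)⟩
    | succ m ih =>
      intro hm
      obtain ⟨X, hX, h⟩ := ih (by omega)
      let w : Fin n := ⟨m, hm⟩
      by_cases hw : w ∈ M
      · have hr : rank M (m + 1) = rank M m + 1 := rank_succ_of_mem hw
        have hlt : ∀ v : Fin n, (v : ℕ) < m → v ∈ M → rank M v < rank M m :=
          fun v hv hvM => rank_lt (w := w) hvM hv
        rw [hr, pow_succ]
        by_cases hwY : w ∈ Y
        · refine ⟨X + 2 ^ rank M m, by omega, fun v hv hvM => ?_⟩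
          rcases Nat.lt_succ_iff_lt_or_eq.1 hv with hv' | hv'
          · rw [← h v hv' hvM]
            obtain ⟨d, hd⟩ := Nat.exists_eq_add_of_lt (hlt v hv' hvM)
            -- The added power of two is an even multiple of `2 ^ rank M v`, so bit `rank M v` does
            -- not change.
            have h3 : 2 ^ rank M m = 2 ^ rank M v * (2 * 2 ^ d) := by
              rw [hd]; ring
            rw [h3, Nat.add_mul_div_left _ _ (by positivity), Nat.add_mul_mod_self_left]
          · obtain rfl : v = w := Fin.ext hv'
            simp only [hwY, iff_true]
            change (X + 2 ^ rank M m) / 2 ^ rank M m % 2 = 1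
            rw [Nat.add_div_right _ (by positivity), Nat.div_eq_of_lt hX]
        · refine ⟨X, by omega, fun v hv hvM => ?_⟩
          rcases Nat.lt_succ_iff_lt_or_eq.1 hv with hv' | hv'
          · exact h v hv' hvM
          · obtain rfl : v = w := Fin.ext hv'
            simp only [hwY, iff_false]
            change ¬ X / 2 ^ rank M m % 2 = 1
            rw [Nat.div_eq_of_lt hX]
            simp
      · have hr : rank M (m + 1) = rank M m := rank_succ_of_notMem hw
        rw [hr]
        refine ⟨X, hX, fun v hv hvM => ?_⟩
        rcases Nat.lt_succ_iff_lt_or_eq.1 hv with hv' | hv'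
        · exact h v hv' hvM
        · obtain rfl : v = w := Fin.ext hv'
          exact absurd hvM hw
  obtain ⟨X, hX, h⟩ := key n le_rfl
  rw [rank_self] at hX
  refine ⟨X, hX, ?_⟩
  ext v
  by_cases hv : v ∈ M
  · rw [mem_decode, weight_of_mem hv, h v v.2 hv]
  · exact iff_of_false (fun hc => hv (decode_weight_subset hc)) (fun hc => hv (hY hc))

/-- The bit of `v` is set in `X`, so the subtraction needs no borrow and clears this bit alone. -/
theorem decode_weight_sub {X : ℕ} {v : Fin n} (hv : v ∈ decode (weight M) X) :
    decode (weight M) (X - weight M v) = (decode (weight M) X).erase v := by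
  have hvM := decode_weight_subset hv
  rw [mem_decode, weight_of_mem hvM] at hv
  rw [weight_of_mem hvM]
  set r := rank M v with hr
  have hlow : ∀ r', r' ≤ r → (X - 2 ^ r) / 2 ^ r' = X / 2 ^ r' - 2 ^ (r - r') := fun r' h => by
    rw [show 2 ^ r = 2 ^ r' * 2 ^ (r - r') by rw [← pow_add]; congr 1; omega,
      Nat.sub_mul_div]
  ext w
  by_cases hw : w ∈ M
  swap
  · exact iff_of_false (fun hc => hw (decode_weight_subset hc))
      fun hc => hw (decode_weight_subset (mem_of_mem_erase hc))
  rw [mem_erase, mem_decode, mem_decode, weight_of_mem hw]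
  have h0 := hlow r le_rfl
  simp only [Nat.sub_self, pow_zero] at h0
  rcases lt_trichotomy v w with h | rfl | h
  · have hlt := rank_lt hvM h
    rw [← hr] at hlt
    obtain ⟨d, hd⟩ := Nat.exists_eq_add_of_lt hlt
    have h3 : 2 ^ rank M w = 2 ^ r * 2 * 2 ^ d := by rw [hd]; ring
    have h4 : ∀ Y, Y / 2 ^ rank M w = Y / 2 ^ r / 2 / 2 ^ d := fun Y => by
      rw [h3, Nat.div_div_eq_div_mul, Nat.div_div_eq_div_mul, mul_assoc]
    -- For the higher bits: `X / 2 ^ r` is odd, so subtracting `1` does not change its half.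
    have h5 : (X / 2 ^ r - 1) / 2 = X / 2 ^ r / 2 := by
      generalize X / 2 ^ r = x at hv
      omega
    rw [h4, h4, h0, h5]
    simp [h.ne']
  · simp only [ne_eq, not_true_eq_false, false_and, iff_false]
    rw [← hr, h0]
    omega
  · have hlt := rank_lt hw h
    rw [← hr] at hlt
    rw [hlow _ hlt.le]
    obtain ⟨d, hd⟩ := Nat.exists_eq_add_of_lt hlt
    -- For the lower bits: an even number is subtracted, and `h4` rules out truncation, so the
    -- parity stays.
    have h3 : 2 ^ (r - rank M w) = 2 * 2 ^ d := by
      rw [hd, show rank M w + d + 1 - rank M w = d + 1 by omega]; ring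
    have h4 : 2 ^ (r - rank M w) ≤ X / 2 ^ rank M w := by
      rw [Nat.le_div_iff_mul_le (by positivity), ← pow_add,
        show r - rank M w + rank M w = r by omega]
      by_contra hc
      rw [Nat.div_eq_of_lt (by omega)] at hv
      simp at hv
    rw [h3] at h4 ⊢
    simp only [ne_eq, h.ne, not_false_eq_true, true_and]
    omega

end

end BCS

/-! ## The program -/

namespace ForLang

open RAM (Op)

instance : Add Ex := ⟨.op .add⟩
instance : Sub Ex := ⟨.op .sub⟩
instance : Mul Ex := ⟨.op .mul⟩
instance : Div Ex := ⟨.op .div⟩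
instance : Mod Ex := ⟨.op .mod⟩
instance (k : ℕ) : OfNat Ex k := ⟨.lit k⟩

section

variable (π : Par) (σ : St) (a b : Ex)

@[simp] theorem eval_add : (a + b).eval σ = a.eval σ + b.eval σ := rfl
@[simp] theorem eval_sub : (a - b).eval σ = a.eval σ - b.eval σ := rfl
@[simp] theorem eval_mul : (a * b).eval σ = a.eval σ * b.eval σ := rfl
@[simp] theorem eval_div : (a / b).eval σ = a.eval σ / b.eval σ := rfl
@[simp] theorem eval_mod : (a % b).eval σ = a.eval σ % b.eval σ := rfl
@[simp] theorem eval_lit (k : ℕ) : (ofNat(k) : Ex).eval σ = ofNat(k) := rfl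
@[simp] theorem eval_var (x : Var) : (Ex.var x).eval σ = σ.v x := rfl
@[simp] theorem eval_arr (x : Arr) : (Ex.arr x a).eval σ = σ.arr x (a.eval σ) := rfl
@[simp] theorem eval_inp : (Ex.inp a).eval σ = σ.inp (a.eval σ) := rfl

@[simp] theorem safe_add : (a + b).Safe π σ ↔
    a.Safe π σ ∧ b.Safe π σ ∧ a.eval σ + b.eval σ < 2 ^ π.L := Iff.rfl
@[simp] theorem safe_mul : (a * b).Safe π σ ↔
    a.Safe π σ ∧ b.Safe π σ ∧ a.eval σ * b.eval σ < 2 ^ π.L := Iff.rfl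
@[simp] theorem safe_sub : (a - b).Safe π σ ↔ a.Safe π σ ∧ b.Safe π σ :=
  and_congr Iff.rfl (iff_of_eq (and_true _))
@[simp] theorem safe_div : (a / b).Safe π σ ↔ a.Safe π σ ∧ b.Safe π σ :=
  and_congr Iff.rfl (iff_of_eq (and_true _))
@[simp] theorem safe_mod : (a % b).Safe π σ ↔ a.Safe π σ ∧ b.Safe π σ :=
  and_congr Iff.rfl (iff_of_eq (and_true _))
@[simp] theorem safe_lit (k : ℕ) : (ofNat(k) : Ex).Safe π σ ↔ ofNat(k) < 2 ^ π.L := Iff.rfl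
@[simp] theorem safe_var (x : Var) : (Ex.var x).Safe π σ := trivial
@[simp] theorem safe_arr (x : Arr) : (Ex.arr x a).Safe π σ ↔ a.Safe π σ := Iff.rfl
@[simp] theorem safe_inp : (Ex.inp a).Safe π σ ↔ a.Safe π σ ∧ a.eval σ < π.N := Iff.rfl

end

end ForLang

namespace BCS

open ForLang ForLang.Ex Finset BranchingWalk

/-- `A := ` the indicator of the vertices that may be used with the mask `X`. -/
def maskCmd : Cmd :=
  .loop false .v (var .n) (.store .A (var .v)
    (arr .S (var .v) * ((1 - arr .P (var .v)) + var .X / arr .P (var .v) % 2)))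

/-- Compute one entry of the table `W`. -/
def cellCmd : Cmd :=
  .assign .acc ((1 - var .s) * arr .A (var .v)) ;;
  .loop false .t (var .s) (.loop false .u (var .n) (
    .assign .acc (var .acc + inp (var .n * var .v + var .u) * arr .W (var .t * var .n + var .u) *
      arr .W ((var .s - 1 - var .t) * var .n + var .v)))) ;;
  .store .W (var .s * var .n + var .v) (var .acc)

/-- Fill the table `W` of the numbers of branching walks inside `A`. -/
def walkCmd : Cmd := .loop false .s (var .n2) (.loop false .v (var .n) cellCmd)

/-- `T[X] := ` the number of branching walks with `2 * k` nodes. -/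
def totalCmd : Cmd :=
  .assign .acc 0 ;;
  .loop false .v (var .n) (
    .assign .acc (var .acc + arr .W ((var .k + var .k - 1) * var .n + var .v))) ;;
  .store .T (var .X) (var .acc)

/-- Fill the table `T`. -/
def tableCmd : Cmd := .loop true .X (var .q) (maskCmd ;; walkCmd ;; totalCmd)

/-- Turn `T` into the table of the numbers of branching walks that visit the whole mask. -/
def moebiusCmd : Cmd :=
  .loop false .v (var .n) (.ite (arr .P (var .v))
    (.loop true .X (var .q) (.ite (var .X / arr .P (var .v) % 2)
      (.store .T (var .X) (arr .T (var .X) - arr .T (var .X - arr .P (var .v)))) .skip))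
    .skip)

/-- `Q := ` the indicator of the mask `X`, `pc := ` its size. -/
def startCmd : Cmd :=
  .assign .pc 0 ;;
  .loop false .v (var .n) (
    .store .Q (var .v) (var .X / arr .P (var .v) % 2) ;;
    .assign .pc (var .pc + arr .Q (var .v)))

/-- Add neighbors to `Q`. -/
def growCmd : Cmd :=
  .loop false .i (var .n) (.loop false .j (var .n) (
    .ite (inp (var .n * var .i + var .j) * arr .A (var .i) * arr .Q (var .j))
      (.store .Q (var .i) 1) .skip))

/-- `acc := ` the number of vertices of weight `0` in `Q`. -/
def countCmd : Cmd :=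
  .assign .acc 0 ;;
  .loop false .v (var .n) (
    .assign .acc (var .acc + (1 - arr .P (var .v)) * arr .Q (var .v)))

/-- Set `ok` if there is a mask that leads to a solution. -/
def checkCmd : Cmd :=
  .assign .ok (1 - var .k) ;;
  .loop true .X (var .q) (
    maskCmd ;; startCmd ;; .loop false .r (var .n) growCmd ;; countCmd ;;
    .ite ((var .pc - var .k) + (var .k - var .pc) + (var .k - var .acc)) .skip
      (.ite (arr .T (var .X)) (.assign .ok 1) .skip))

/-- `ok := ` whether there is a solution of size `2 * k` inside `S`. -/
def decideCmd : Cmd := tableCmd ;; moebiusCmd ;; checkCmd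

/-- Compute the weights of the vertices of the smaller color class, and select all vertices. -/
def setupCmd : Cmd :=
  .assign .c 0 ;;
  .loop false .v (var .n) (.assign .c (var .c + inp (var .n * var .n + var .v))) ;;
  .assign .n1 (var .n + 1) ;;
  .assign .n2 (var .n + var .n) ;;
  .assign .q 1 ;;
  .loop false .v (var .n) (
    .store .S (var .v) 1 ;;
    .ite (var .c + var .c - var .n)
      (.assign .acc (1 - inp (var .n * var .n + var .v)))
      (.assign .acc (inp (var .n * var .n + var .v))) ;;
    .store .P (var .v) (var .acc * var .q) ;;
    .assign .q (var .q + arr .P (var .v)))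

/-- Find the largest `k`, then remove vertices as long as there is a solution of size `2 * k`. -/
def searchCmd : Cmd :=
  .assign .best 0 ;;
  .loop false .k (var .n1) (decideCmd ;; .ite (var .ok) (.assign .best (var .k)) .skip) ;;
  .assign .k (var .best) ;;
  .loop false .z (var .n) (
    .store .S (var .z) 0 ;; decideCmd ;; .ite (var .ok) .skip (.store .S (var .z) 1))

/-- The whole program. -/
def mainCmd : Cmd :=
  setupCmd ;; searchCmd ;; .loop false .v (var .n) (.out (var .v) (arr .S (var .v)))

/-! ### Correctness -/

/-- The parameters are large enough for instances with `n` vertices. -/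
structure Fits (π : Par) (n : ℕ) : Prop where
  N : π.N = n * n + n
  p : 2 * n + 1 ≤ π.p
  walk : n * 2 ^ ((n + 1) * (2 * n) ^ 2) < 2 ^ π.L
  idx : 4 * (n + 1) * (n + 1) < 2 ^ π.L
  pow : 4 * 2 ^ n < 2 ^ π.L

theorem Fits.lin {π : Par} {n : ℕ} (h : Fits π n) : 4 * n + 4 < 2 ^ π.L := by
  have := h.idx
  nlinarith

theorem Fits.L_ne_zero {π : Par} {n : ℕ} (h : Fits π n) : π.L ≠ 0 := by
  have := h.lin
  intro h0
  rw [h0] at this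
  omega

theorem Fits.quad {π : Par} {n : ℕ} (h : Fits π n) : 4 * (n * n) + 8 * n + 4 < 2 ^ π.L := by
  have := h.idx
  nlinarith

/-- `f` is the indicator of `A`. -/
def Ind {n : ℕ} (f : ℕ → ℕ) (A : Finset (Fin n)) : Prop :=
  ∀ v : Fin n, f v = if v ∈ A then 1 else 0

/-- The state after the setup. -/
structure Base (π : Par) {n : ℕ} (G : SimpleGraph (Fin n)) [DecidableRel G.Adj]
    (M : Finset (Fin n)) (σ : St) : Prop where
  vn : σ.v .n = n
  vn2 : σ.v .n2 = 2 * n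
  q : σ.v .q = 2 ^ M.card
  q_le : 2 ^ M.card ≤ π.g
  P : ∀ v : Fin n, σ.arr .P v = weight M v
  inp : ∀ i j : Fin n, σ.inp (n * i + j) = if G.Adj i j then 1 else 0

section

variable {π : Par} {n : ℕ} {G : SimpleGraph (Fin n)} [DecidableRel G.Adj] {M : Finset (Fin n)}
  {σ τ : St}

/-- The side condition on the write sets is a Boolean computation, so `rfl` proves it for each
concrete command. -/
theorem Base.frame (h : Base π G M σ) {c : Cmd} (hf : Frame c σ τ)
    (hc : (c.wv .n || c.wv .n2 || c.wv .q || c.wa .P || c.wi) = false) : Base π G M τ := by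
  simp only [Bool.or_eq_false_iff] at hc
  obtain ⟨⟨⟨⟨h1, h2⟩, h3⟩, h4⟩, h5⟩ := hc
  exact ⟨by rw [hf.v _ h1, h.vn], by rw [hf.v _ h2, h.vn2], by rw [hf.v _ h3, h.q], h.q_le,
    by rw [hf.arr _ h4]; exact h.P, by rw [hf.inp h5]; exact h.inp⟩

/-- The vertices that may be used with the mask `X`. -/
abbrev usable (M S : Finset (Fin n)) (X : ℕ) : Finset (Fin n) :=
  allowed M S (decode (weight M) X)

/-- At most one summand in the parentheses is nonzero: weights in `M` are positive, so `1 - weight M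
v` truncates to `0` there, while outside `M` the weight is `0` and the quotient by it vanishes. -/
theorem usable_eq (S : Finset (Fin n)) (X : ℕ) (v : Fin n) :
    (if v ∈ S then 1 else 0) * ((1 - weight M v) + X / weight M v % 2) =
      if v ∈ usable M S X then 1 else 0 := by
  by_cases hS : v ∈ S
  · by_cases hM : v ∈ M
    · have h1 : 1 - weight M v = 0 := by
        have := weight_ne_zero.2 hM
        omega
      have h2 : v ∈ usable M S X ↔ X / weight M v % 2 = 1 := by
        simp [usable, allowed, hS, hM, mem_decode]
      simp only [h2, hS, h1]
      by_cases hx : X / weight M v % 2 = 1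
      · simp [hx]
      · simp [hx]; omega
    · simp [usable, allowed, hS, hM, weight_of_notMem hM]
  · simp [usable, allowed, hS]

theorem mask_spec (hfit : Fits π n) (h : Base π G M σ) {S : Finset (Fin n)}
    (hS : Ind (σ.arr .S) S) :
    Tri π maskCmd σ (fun τ => Ind (τ.arr .A) (usable M S (σ.v .X))) := by
  have hlin := hfit.lin
  have hp := hfit.p
  refine Tri.loop (fun i τ => ∀ v : Fin n, (v : ℕ) < i →
    τ.arr .A v = if v ∈ usable M S (σ.v .X) then 1 else 0) (by simp) rfl ?_ ?_ ?_ ?_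
  · simp [h.vn, Par.bound]; omega
  · intro v hv
    omega
  · intro i τ hi hf hv hI
    have hX : τ.v .X = σ.v .X := hf.v _ rfl
    have hP : τ.arr .P = σ.arr .P := hf.arr _ rfl
    have hSS : τ.arr .S = σ.arr .S := hf.arr _ rfl
    simp only [eval_var, h.vn] at hi
    have key := usable_eq (M := M) S (σ.v .X) ⟨i, hi⟩
    have hPi := h.P ⟨i, hi⟩
    have hSi := hS ⟨i, hi⟩
    simp only at hPi hSi key
    have h01 : (if (⟨i, hi⟩ : Fin n) ∈ usable M S (σ.v .X) then 1 else 0) ≤ 1 := by split <;> simp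
    refine Tri.store (by simp) ?_ ?_
    · simp only [safe_mul, safe_arr, safe_add, safe_sub, safe_div, safe_mod, safe_lit, safe_var,
        eval_add, eval_sub, eval_arr, eval_var, eval_mod, eval_div, eval_lit, hv, hX, hP, hSS,
        hPi, hSi, key, true_and, and_true]
      omega
    · intro v hv'
      simp only [eval_add, eval_sub, eval_arr, eval_var, eval_mod, eval_div, eval_lit, hv, hX, hP,
        hSS, eval_mul, hPi, hSi, key, St.setV_arr, St.setA_arr_self]
      by_cases hvi : (v : ℕ) = i
      · simp [hvi]
        subst hvi
        rfl
      · rw [if_neg hvi]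
        exact hI v (by omega)
  · intro τ hf hv hI v
    exact hI v (by simp [h.vn])

end

/-! ### The table of walk counts -/

theorem row_index_inj {n s v s' v' : ℕ} (hv : v < n) (hv' : v' < n)
    (h : s * n + v = s' * n + v') : s = s' ∧ v = v' := by
  have h1 : (s * n + v) % n = v := by rw [Nat.mul_add_mod', Nat.mod_eq_of_lt hv]
  have h2 : (s' * n + v') % n = v' := by rw [Nat.mul_add_mod', Nat.mod_eq_of_lt hv']
  obtain rfl : v = v' := by rw [← h1, h, h2]
  exact ⟨Nat.eq_of_mul_eq_mul_right (by omega) (Nat.add_right_cancel h), rfl⟩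

/-- The truncated factor `1 - s` switches the base case on at `s = 0` only, so that one loop body
serves for all rows. -/
theorem walkCount_eq {n : ℕ} {e : ℕ → ℕ → ℕ} {a : ℕ → ℕ} {s v : ℕ} :
    walkCount n e a s v = (1 - s) * a v + ∑ t ∈ range s, ∑ u ∈ range n,
      e v u * walkCount n e a t u * walkCount n e a (s - 1 - t) v := by
  cases s with
  | zero => simp [walkCount_zero]
  | succ s => simp [walkCount_succ]

/-- Intermediate values of the accumulator are partial sums of the final count, so a bound for the
latter is also a bound for them. -/
theorem partial_le_walkCount {n : ℕ} {e : ℕ → ℕ → ℕ} {a : ℕ → ℕ} {s v t u : ℕ} (ht : t < s)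
    (hu : u < n) :
    (1 - s) * a v + ∑ t ∈ range t, ∑ u ∈ range n,
      e v u * walkCount n e a t u * walkCount n e a (s - 1 - t) v +
      ∑ u ∈ range (u + 1), e v u * walkCount n e a t u * walkCount n e a (s - 1 - t) v ≤
    walkCount n e a s v := by
  rw [walkCount_eq (s := s), add_assoc]
  gcongr
  calc _ ≤ _ := Nat.add_le_add_left (sum_le_sum_of_subset (range_subset_range.2 hu)) _
    _ = ∑ t ∈ range (t + 1), ∑ u ∈ range n,
      e v u * walkCount n e a t u * walkCount n e a (s - 1 - t) v := (sum_range_succ _ _).symm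
    _ ≤ _ := sum_le_sum_of_subset (range_subset_range.2 ht)

section

variable {π : Par} {n : ℕ} {G : SimpleGraph (Fin n)} [DecidableRel G.Adj] {M : Finset (Fin n)}
  {σ τ : St}

theorem Base.inp_le (h : Base π G M σ) : ∀ i < n, ∀ j < n, σ.inp (n * i + j) ≤ 1 := by
  intro i hi j hj
  have := h.inp ⟨i, hi⟩ ⟨j, hj⟩
  simp only at this
  rw [this]
  split <;> simp

theorem Ind.le_one {f : ℕ → ℕ} {A : Finset (Fin n)} (h : Ind f A) : ∀ v < n, f v ≤ 1 := by
  intro v hv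
  have := h ⟨v, hv⟩
  simp only at this
  rw [this]
  split <;> simp

/-- The adjacency matrix that is stored in the state. -/
def adjOf (n : ℕ) (σ : St) : ℕ → ℕ → ℕ := fun i j => σ.inp (n * i + j)

theorem sum_walkCount_lt (hfit : Fits π n) {e : ℕ → ℕ → ℕ} {a : ℕ → ℕ}
    (he : ∀ i < n, ∀ j < n, e i j ≤ 1) (ha : ∀ v < n, a v ≤ 1) {s : ℕ} (hs : s ≤ 2 * n) {m : ℕ}
    (hm : m ≤ n) : ∑ v ∈ range m, walkCount n e a s v < 2 ^ π.L := by
  refine lt_of_le_of_lt ?_ hfit.walk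
  calc _ ≤ ∑ v ∈ range m, 2 ^ ((n + 1) * (2 * n) ^ 2) := sum_le_sum fun v hv =>
        (walkCount_le he ha s v ((mem_range.1 hv).trans_le hm)).trans (by gcongr; omega)
    _ = m * 2 ^ ((n + 1) * (2 * n) ^ 2) := by simp
    _ ≤ _ := by gcongr

theorem walkCount_lt (hfit : Fits π n) {e : ℕ → ℕ → ℕ} {a : ℕ → ℕ}
    (he : ∀ i < n, ∀ j < n, e i j ≤ 1) (ha : ∀ v < n, a v ≤ 1) {s : ℕ} (hs : s ≤ 2 * n) {v : ℕ}
    (hv : v < n) : walkCount n e a s v < 2 ^ π.L :=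
  (single_le_sum (f := walkCount n e a s) (fun _ _ => Nat.zero_le _) (mem_range.2 hv)).trans_lt
    (sum_walkCount_lt hfit he ha hs le_rfl)

theorem row_index_lt (hfit : Fits π n) {s v : ℕ} (hs : s < 2 * n) (hv : v < n) :
    s * n + v < 2 ^ π.L := by
  have h1 := hfit.quad
  have h2 : s * n ≤ 2 * n * n := Nat.mul_le_mul_right n hs.le
  nlinarith

theorem matrix_index_lt {i j : ℕ} (hi : i < n) (hj : j < n) : n * i + j < n * n := by
  have : n * (i + 1) ≤ n * n := Nat.mul_le_mul_left n hi
  rw [mul_add] at this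
  omega

theorem cell_spec (hfit : Fits π n) (h : Base π G M σ) (ha : ∀ v < n, σ.arr .A v ≤ 1)
    (hs : σ.v .s < 2 * n) (hv : σ.v .v < n)
    (hW : ∀ s < σ.v .s, ∀ v < n, σ.arr .W (s * n + v) = walkCount n (adjOf n σ) (σ.arr .A) s v) :
    Tri π cellCmd σ (fun τ => τ.arr .W (σ.v .s * n + σ.v .v) =
        walkCount n (adjOf n σ) (σ.arr .A) (σ.v .s) (σ.v .v) ∧
      ∀ j, j ≠ σ.v .s * n + σ.v .v → τ.arr .W j = σ.arr .W j) := by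
  have hlin := hfit.lin
  have hquad := hfit.quad
  have hp := hfit.p
  have hN := hfit.N
  have he : ∀ i < n, ∀ j < n, adjOf n σ i j ≤ 1 := h.inp_le
  have hsn := row_index_lt hfit hs hv
  have hmat := fun u (hu : u < n) => matrix_index_lt hv hu
  have hnv := hmat 0 (by omega)
  set s := σ.v .s with hsdef
  set v := σ.v .v with hvdef
  set a := σ.arr .A with hadef
  set w := walkCount n (adjOf n σ) a with hw
  have hwlt := fun t (ht : t ≤ 2 * n) u (hu : u < n) => walkCount_lt hfit he ha ht hu
  have hav := ha v hv
  refine Tri.seq (Tri.assign ?_ (Tri.seq (Tri.loop (fun t τ => τ.v .acc = (1 - s) * a v +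
    ∑ t ∈ range t, ∑ u ∈ range n, adjOf n σ v u * w t u * w (s - 1 - t) v) (by simp) rfl ?_ ?_ ?_
    (fun τ hf _ hI => Tri.store ?_ (by simp) ?_))))
  · simp only [safe_mul, safe_sub, safe_lit, safe_var, safe_arr, eval_sub, eval_lit,
      eval_var, eval_arr, ← hsdef, ← hvdef, ← hadef, and_true, true_and]
    refine ⟨by omega, ?_⟩
    have h1 : (1 - s) * a v ≤ 1 * 1 := Nat.mul_le_mul (Nat.sub_le 1 s) hav
    omega
  · simp [Par.bound, ← hsdef]; omega
  · simp [← hsdef, ← hvdef, ← hadef]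
  · intro t τ ht hf htv hI
    have hτs : τ.v .s = s := hf.v _ rfl
    have hτv : τ.v .v = v := hf.v _ rfl
    have hτn : τ.v .n = n := (hf.v _ rfl).trans h.vn
    have hτW : τ.arr .W = σ.arr .W := hf.arr _ rfl
    have hτi : τ.inp = σ.inp := hf.inp rfl
    have ht' : t < s := by simpa [← hsdef] using ht
    refine Tri.loop (fun u τ => τ.v .acc = (1 - s) * a v +
      ∑ t ∈ range t, ∑ u ∈ range n, adjOf n σ v u * w t u * w (s - 1 - t) v +
      ∑ u ∈ range u, adjOf n σ v u * w t u * w (s - 1 - t) v) (by simp) rfl ?_ ?_ ?_ ?_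
    · simp [Par.bound, hτn]; omega
    · simp [hI]
    · intro u ρ hu hf' huv hJ
      have hρs : ρ.v .s = s := (hf'.v _ rfl).trans hτs
      have hρv : ρ.v .v = v := (hf'.v _ rfl).trans hτv
      have hρn : ρ.v .n = n := (hf'.v _ rfl).trans hτn
      have hρt : ρ.v .t = t := (hf'.v _ rfl).trans htv
      have hρW : ρ.arr .W = σ.arr .W := (hf'.arr _ rfl).trans hτW
      have hρi : ρ.inp = σ.inp := (hf'.inp rfl).trans hτi
      have hu' : u < n := by simpa [hτn] using hu
      have hpart := partial_le_walkCount (e := adjOf n σ) (a := a) (v := v) ht' hu'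
      have hlt := hwlt s hs.le v hv
      have h1 := hW t ht' u hu'
      have h2 := hW (s - 1 - t) (by omega) v hv
      have h3 : σ.inp (n * v + u) = adjOf n σ v u := rfl
      have h4 := hwlt t (by omega) u hu'
      -- The product of the first two factors is evaluated on its own and needs its own bound.
      have h5 : adjOf n σ v u * w t u ≤ 1 * w t u := Nat.mul_le_mul_right _ (he v hv u hu')
      have h6 := row_index_lt hfit (s := t) (by omega) hu'
      have h7 := row_index_lt hfit (s := s - 1 - t) (by omega) hv
      have h8 := hmat u hu'
      rw [sum_range_succ, ← add_assoc] at hpart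
      refine Tri.assign ?_ ?_
      · simp only [safe_mul, safe_sub, safe_lit, safe_var, safe_arr, safe_add, safe_inp, eval_mul,
          eval_sub, eval_lit, eval_var, eval_arr, eval_add, eval_inp, hρs, hρv, hρn, hρt, hρW, hρi,
          huv, h1, h2, h3, hJ, and_true, true_and]
        rw [← hw] at hpart hlt h4
        omega
      · simp [hρs, hρv, hρn, hρt, hρW, hρi, huv, h1, h2, h3, hJ, sum_range_succ]
        ring
    · intro ρ hf' huv hJ
      simp only [eval_var, hτn] at hJ
      simp [hJ, sum_range_succ]
      ring
  · have hτs : τ.v .s = s := hf.v _ rfl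
    have hτv : τ.v .v = v := hf.v _ rfl
    have hτn : τ.v .n = n := (hf.v _ rfl).trans h.vn
    simp [hτs, hτv, hτn]
    omega
  · have hτs : τ.v .s = s := hf.v _ rfl
    have hτv : τ.v .v = v := hf.v _ rfl
    have hτn : τ.v .n = n := (hf.v _ rfl).trans h.vn
    have hτW : τ.arr .W = σ.arr .W := hf.arr _ rfl
    simp only [eval_var, St.setV_v] at hI
    refine ⟨?_, fun j hj => ?_⟩
    · simp only [eval_add, eval_mul, eval_var, hτs, hτv, hτn, St.setA_arr_self, if_true]
      rw [hI, hw, walkCount_eq (s := s)]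
      simp [← hsdef]
    · simp [hτs, hτv, hτn, hτW, hj]

theorem walk_spec (hfit : Fits π n) (h : Base π G M σ) (ha : ∀ v < n, σ.arr .A v ≤ 1) :
    Tri π walkCmd σ (fun τ => ∀ s < 2 * n, ∀ v < n,
      τ.arr .W (s * n + v) = walkCount n (adjOf n σ) (σ.arr .A) s v) := by
  have hp := hfit.p
  refine Tri.loop (fun s τ => ∀ s' < s, ∀ v < n,
    τ.arr .W (s' * n + v) = walkCount n (adjOf n σ) (σ.arr .A) s' v) (by simp) rfl ?_ ?_ ?_ ?_
  · simp [Par.bound, h.vn2]; omega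
  · intro s hs
    omega
  · intro s τ hs hf hsv hI
    have hs' : s < 2 * n := by simpa [h.vn2] using hs
    have hb : Base π G M τ := h.frame hf rfl
    have hA : τ.arr .A = σ.arr .A := hf.arr _ rfl
    have hi : τ.inp = σ.inp := hf.inp rfl
    refine Tri.loop (fun v ρ => ∀ s' v', v' < n → (s' < s ∨ s' = s ∧ v' < v) →
      ρ.arr .W (s' * n + v') = walkCount n (adjOf n σ) (σ.arr .A) s' v') (by simp) rfl ?_ ?_ ?_ ?_
    · simp [Par.bound, hb.vn]; omega
    · rintro s' v' hv' (h1 | h1)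
      · exact hI s' h1 v' hv'
      · omega
    · intro v ρ hv hf' hvv hJ
      have hv' : v < n := by simpa [hb.vn] using hv
      have hρs : ρ.v .s = s := (hf'.v _ rfl).trans hsv
      have hρA : ρ.arr .A = σ.arr .A := (hf'.arr _ rfl).trans hA
      have hρi : adjOf n ρ = adjOf n σ := by
        unfold adjOf
        rw [(hf'.inp rfl).trans hi]
      refine Tri.mono (cell_spec hfit (hb.frame hf' rfl) (by rwa [hρA]) (by omega) (by omega)
        fun s' h1 v' h2 => ?_) fun ν _ hf'' ⟨h1, h2⟩ => ?_
      · rw [hρA, hρi]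
        exact hJ s' v' h2 (.inl (by omega))
      · rw [hρA, hρi, hρs, hvv] at h1
        rw [hρs, hvv] at h2
        intro s' v' hvn hcase
        rw [St.setV_arr]
        by_cases hc : s' = s ∧ v' = v
        · rw [hc.1, hc.2, h1]
        · rw [h2 _ fun hcon => hc (row_index_inj hvn hv' hcon)]
          exact hJ s' v' hvn (by omega)
    · intro ρ hf' hvv hJ s' hs'' v' hv'
      rw [St.setV_arr]
      simp only [eval_var, hb.vn] at hJ
      exact hJ s' v' hv' (by omega)
  · intro τ hf hsv hI s hs v hv
    exact hI s (by simpa [h.vn2] using hs) v hv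

theorem total_spec (hfit : Fits π n) (h : Base π G M σ) {A : Finset (Fin n)}
    (hA : Ind (σ.arr .A) A) (hk : σ.v .k ≤ n)
    (hW : ∀ s < 2 * n, ∀ v < n,
      σ.arr .W (s * n + v) = walkCount n (adjOf n σ) (σ.arr .A) s v) :
    Tri π totalCmd σ (fun τ => τ.arr .T (σ.v .X) = covCount G (2 * σ.v .k - 1) A ∅ ∧
      ∀ j, j ≠ σ.v .X → τ.arr .T j = σ.arr .T j) := by
  have hlin := hfit.lin
  have hp := hfit.p
  have he : ∀ i < n, ∀ j < n, adjOf n σ i j ≤ 1 := h.inp_le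
  set s := 2 * σ.v .k - 1 with hs
  have hcov := covCount_empty G (e := adjOf n σ) (a := σ.arr .A) h.inp hA s
  refine Tri.seq (Tri.assign (by simp) (Tri.seq (Tri.loop (fun v τ => τ.v .acc =
    ∑ v ∈ range v, walkCount n (adjOf n σ) (σ.arr .A) s v) (by simp) rfl ?_ ?_ ?_
    (fun τ hf _ hI => Tri.store (by simp) (by simp) ?_))))
  · simp [Par.bound, h.vn]; omega
  · simp
  · intro v τ hv hf hvv hI
    have hτn : τ.v .n = n := (hf.v _ rfl).trans h.vn
    have hτk : τ.v .k = σ.v .k := hf.v _ rfl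
    have hτW : τ.arr .W = σ.arr .W := hf.arr _ rfl
    have hv' : v < n := by simpa [h.vn] using hv
    -- For `k = 0` the truncated index is `0`, still a row of the table since `v < n` makes `n`
    -- positive; the test does not depend on that count.
    have hss : s < 2 * n := by omega
    have hks : σ.v .k + σ.v .k - 1 = s := by omega
    have h1 := hW s hss v hv'
    have h2 := row_index_lt hfit hss hv'
    have h3 := sum_walkCount_lt hfit he hA.le_one hss.le (m := v + 1) hv'
    rw [sum_range_succ] at h3
    refine Tri.assign ?_ ?_
    · simp [hτn, hτk, hτW, hvv, hks, h1, hI, hfit.L_ne_zero]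
      omega
    · simp [hτn, hτk, hτW, hvv, hks, h1, hI, sum_range_succ]
  · have hτX : τ.v .X = σ.v .X := hf.v _ rfl
    have hτT : τ.arr .T = σ.arr .T := hf.arr _ rfl
    simp only [eval_var, St.setV_v, reduceCtorEq, if_false, h.vn] at hI
    refine ⟨by simp [hτX, hI, hcov], fun j hj => by simp [hτX, hj, hτT]⟩

theorem table_spec (hfit : Fits π n) (h : Base π G M σ) {S : Finset (Fin n)}
    (hS : Ind (σ.arr .S) S) (hk : σ.v .k ≤ n) :
    Tri π tableCmd σ (fun τ => ∀ X < 2 ^ M.card,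
      τ.arr .T X = covCount G (2 * σ.v .k - 1) (usable M S X) ∅) := by
  refine Tri.loop (fun X τ => ∀ X' < X,
    τ.arr .T X' = covCount G (2 * σ.v .k - 1) (usable M S X') ∅) (by simp) rfl ?_ ?_ ?_ ?_
  · simp [Par.bound, h.q, h.q_le]
  · intro X hX
    omega
  · intro X τ hX hf hXv hI
    have hb : Base π G M τ := h.frame hf rfl
    have hS' : Ind (τ.arr .S) S := by rwa [hf.arr .S rfl]
    refine Tri.seq (Tri.mono (mask_spec hfit hb hS') fun τ₁ _ f₁ h₁ => Tri.seq (Tri.mono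
      (walk_spec hfit (hb.frame f₁ rfl) h₁.le_one) fun τ₂ _ f₂ h₂ => ?_))
    have hA₂ : τ₂.arr .A = τ₁.arr .A := f₂.arr _ rfl
    have hi₂ : adjOf n τ₁ = adjOf n τ₂ := by
      unfold adjOf
      rw [f₂.inp rfl]
    have hk₂ : τ₂.v .k = σ.v .k := (f₂.v _ rfl).trans ((f₁.v _ rfl).trans (hf.v _ rfl))
    have hX₂ : τ₂.v .X = X := (f₂.v _ rfl).trans ((f₁.v _ rfl).trans hXv)
    have hT₂ : τ₂.arr .T = τ.arr .T := (f₂.arr _ rfl).trans (f₁.arr _ rfl)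
    refine Tri.mono (total_spec (A := usable M S X) hfit ((hb.frame f₁ rfl).frame f₂ rfl)
      (by rwa [hA₂, ← hXv])
      (by omega) ?_) fun τ₃ _ f₃ ⟨h₃, h₄⟩ => ?_
    · rw [hA₂, ← hi₂]
      exact h₂
    · intro X' hX'
      rw [St.setV_arr]
      rw [hX₂, hk₂] at h₃
      rw [hX₂, hT₂] at h₄
      by_cases hc : X' = X
      · rw [hc, h₃]
      · rw [h₄ _ hc]
        exact hI _ (by omega)
  · intro τ hf hXv hI X hX
    exact hI X (by simpa [h.q] using hX)

end

/-! ### Inclusion-exclusion over all masks, in place -/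

section

variable {π : Par} {n : ℕ} {G : SimpleGraph (Fin n)} [DecidableRel G.Adj] {M : Finset (Fin n)}
  {σ τ : St}

/-- The members of the mask `X` below `v`. -/
def below (M : Finset (Fin n)) (X v : ℕ) : Finset (Fin n) :=
  (decode (weight M) X).filter fun w : Fin n => (w : ℕ) < v

theorem below_zero (X : ℕ) : below M X 0 = ∅ := by simp [below]

theorem below_self (X : ℕ) : below M X n = decode (weight M) X := by simp [below]

theorem below_succ (X : ℕ) (v : Fin n) : below M X (v + 1) =
    if v ∈ decode (weight M) X then insert v (below M X v) else below M X v := by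
  ext w
  split <;> rename_i h <;> simp only [below, mem_filter, mem_insert, Nat.lt_succ_iff_lt_or_eq,
    ← Fin.ext_iff]
  · constructor
    · tauto
    · rintro (rfl | h')
      · exact ⟨h, .inr rfl⟩
      · tauto
  · constructor
    · rintro ⟨h1, h2 | rfl⟩
      · exact ⟨h1, h2⟩
      · exact absurd h1 h
    · tauto

theorem below_sub {X : ℕ} {v : Fin n} (h : v ∈ decode (weight M) X) :
    below M (X - weight M v) (v + 1) = below M X v := by
  rw [below, decode_weight_sub h]
  ext w
  simp only [below, mem_filter, mem_erase, Nat.lt_succ_iff_lt_or_eq, ← Fin.ext_iff]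
  constructor
  · tauto
  · rintro ⟨h1, h2⟩
    refine ⟨⟨?_, h1⟩, .inl h2⟩
    rintro rfl
    omega

/-- Since `v ∈ M`, the mask is the only reason why `v` may be used; clearing its bit removes it. The
entry at `X - weight M v` is therefore the subtrahend that `covCount_insert` asks for. -/
theorem usable_sub {S : Finset (Fin n)} {X : ℕ} {v : Fin n} (h : v ∈ decode (weight M) X) :
    usable M S (X - weight M v) = (usable M S X).erase v := by
  have hvM := decode_weight_subset h
  rw [usable, decode_weight_sub h]
  ext w
  simp only [usable, allowed, mem_inter, mem_union, mem_erase, mem_compl]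
  constructor
  · rintro ⟨⟨h1, h2⟩ | h1, h3⟩
    · exact ⟨h1, .inl h2, h3⟩
    · exact ⟨fun hc => h1 (hc ▸ hvM), .inr h1, h3⟩
  · tauto

/-- After the rounds for the vertices below `v`, entry `X` counts the walks that visit all members
of the mask below `v`. A round adds `v` to this requirement in the masks that contain it. -/
theorem moebius_spec (hfit : Fits π n) (h : Base π G M σ) {S : Finset (Fin n)} {s : ℕ}
    (hT : ∀ X < 2 ^ M.card, σ.arr .T X = covCount G s (usable M S X) ∅) :
    Tri π moebiusCmd σ (fun τ => ∀ X < 2 ^ M.card,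
      τ.arr .T X = covCount G s (usable M S X) (decode (weight M) X)) := by
  have hp := hfit.p
  have hlin := hfit.lin
  refine Tri.loop (fun v τ => ∀ X < 2 ^ M.card,
    τ.arr .T X = covCount G s (usable M S X) (below M X v)) (by simp) rfl ?_ ?_ ?_ ?_
  · simp [Par.bound, h.vn]; omega
  · simpa [below_zero] using hT
  · intro v τ hv hf hvv hI
    have hb : Base π G M τ := h.frame hf rfl
    have hv' : v < n := by simpa [h.vn] using hv
    let w : Fin n := ⟨v, hv'⟩
    have hPw : τ.arr .P v = weight M v := hb.P w
    refine Tri.ite (by simp) (fun hP => ?_) (fun hP => Tri.skip ?_)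
    · simp only [eval_arr, eval_var, hvv, hPw] at hP
      have hwM : w ∈ M := weight_ne_zero.1 hP
      refine Tri.loop (fun X ρ => ∀ X' < 2 ^ M.card, ρ.arr .T X' = covCount G s (usable M S X')
        (below M X' (if X' < X then v + 1 else v))) (by simp) rfl ?_ ?_ ?_ ?_
      · simp [Par.bound, hb.q, hb.q_le]
      · simpa using hI
      · intro X ρ hX hf' hXv hJ
        have hρv : ρ.v .v = v := (hf'.v _ rfl).trans hvv
        have hρP : ρ.arr .P v = weight M v := by rw [hf'.arr .P rfl, hPw]
        have hXq : X < 2 ^ M.card := by simpa [hb.q] using hX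
        have hsucc := below_succ (M := M) X w
        refine Tri.ite (by simp; omega) (fun hbit => Tri.store (by simp) (by simp) ?_)
          (fun hbit => Tri.skip ?_)
        · simp only [eval_mod, eval_div, eval_var, eval_arr, eval_lit, hXv, hρv, hρP] at hbit
          have hmem : w ∈ decode (weight M) X := by
            rw [mem_decode]
            change X / weight M v % 2 = 1
            omega
          rw [if_pos hmem] at hsucc
          have hle : weight M v ≤ X := by
            by_contra hc
            rw [Nat.div_eq_of_lt (by omega)] at hbit
            exact hbit rfl
          -- The entry at `X - weight M v` has already been treated in this round. This does no
          -- harm: `v` is not in that mask, so its requirement is the same for `v + 1` as for `v`.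
          have e1 := below_sub hmem
          have e2 := usable_sub (S := S) hmem
          intro X' hX'
          simp only [eval_var, eval_sub, eval_arr, hXv, hρv, hρP, St.setV_arr, St.setA_arr_self]
          by_cases hXX : X' = X
          · subst hXX
            rw [if_pos rfl, if_pos (Nat.lt_succ_self _), hJ X' hX', if_neg (lt_irrefl _),
              hJ _ (by omega), if_pos (by omega)]
            change _ = covCount G s _ (below M X' (w + 1))
            rw [hsucc, covCount_insert, ← e2, ← e1]
          · rw [if_neg hXX, hJ X' hX']
            congr 2
            simp only [show X' < X + 1 ↔ X' < X by omega]
        · simp only [eval_mod, eval_div, eval_var, eval_arr, eval_lit, hXv, hρv, hρP] at hbit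
          have hmem : w ∉ decode (weight M) X := by
            rw [mem_decode]
            change ¬ X / weight M v % 2 = 1
            omega
          rw [if_neg hmem] at hsucc
          intro X' hX'
          rw [St.setV_arr, hJ X' hX']
          by_cases hXX : X' = X
          · subst hXX
            simp only [lt_irrefl, if_false, Nat.lt_succ_self, if_true]
            exact congrArg _ hsucc.symm
          · simp only [show X' < X + 1 ↔ X' < X by omega]
      · intro ρ hf' hXv hJ X hX
        rw [St.setV_arr, hJ X hX, eval_var, hb.q, if_pos hX]
    · simp only [eval_arr, eval_var, hvv, hPw] at hP
      intro X hX
      have hmem : w ∉ decode (weight M) X := fun hc =>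
        weight_ne_zero.2 (decode_weight_subset hc) hP
      have hsucc := below_succ (M := M) X w
      rw [if_neg hmem] at hsucc
      rw [St.setV_arr, hI X hX]
      exact congrArg _ hsucc.symm
  · intro τ hf hvv hI X hX
    rw [hI X hX, eval_var, h.vn, below_self]

theorem start_spec (hfit : Fits π n) (h : Base π G M σ) :
    Tri π startCmd σ (fun τ => Ind (n := n) (τ.arr .Q) (decode (weight M) (σ.v .X)) ∧
      τ.v .pc = (decode (n := n) (weight M) (σ.v .X)).card) := by
  have hp := hfit.p
  have hlin := hfit.lin
  set D : Finset (Fin n) := decode (weight M) (σ.v .X) with hD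
  have hcard : D.card ≤ n := by simpa using card_le_univ D
  refine Tri.seq (Tri.assign (by simp) (Tri.loop (fun v τ => τ.v .pc = rank D v ∧
    ∀ w : Fin n, (w : ℕ) < v → τ.arr .Q w = if w ∈ D then 1 else 0) (by simp) rfl ?_ ?_ ?_ ?_))
  · simp [Par.bound, h.vn]; omega
  · simp [rank_zero]
  · rintro v τ hv hf hvv ⟨hI, hI'⟩
    have hv' : v < n := by simpa [h.vn] using hv
    let w : Fin n := ⟨v, hv'⟩
    have hPw : τ.arr .P v = weight M v := by
      rw [hf.arr .P rfl]
      exact h.P w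
    have hX : τ.v .X = σ.v .X := hf.v _ rfl
    have hbit : σ.v .X / weight M v % 2 = if w ∈ D then 1 else 0 := by
      have hiff : w ∈ D ↔ σ.v .X / weight M v % 2 = 1 := mem_decode
      split <;> rename_i hw <;> rw [hiff] at hw <;> omega
    have hrank : rank D (v + 1) = rank D v + if w ∈ D then 1 else 0 := by
      split
      · exact rank_succ_of_mem (v := w) (by assumption)
      · exact rank_succ_of_notMem (v := w) (by assumption)
    have hle : rank D (v + 1) ≤ D.card := rank_self (M := D) ▸ rank_mono hv'
    refine Tri.seq (Tri.store (by simp) ?_ (Tri.assign ?_ ?_))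
    · simp only [safe_mod, safe_div, safe_var, safe_arr, safe_lit, true_and]
      omega
    · simp only [safe_add, safe_var, safe_arr, eval_var, eval_mod, eval_div, eval_arr, eval_lit, hvv,
        hPw, hX, hbit, St.setA_v, St.setA_arr_self, if_true, hI, ← hrank, true_and]
      omega
    · simp only [eval_var, eval_mod, eval_div, eval_arr, eval_lit, eval_add, hvv, hPw, hX, hbit,
        St.setA_v, St.setA_arr_self, if_true, hI, St.setV_v, St.setV_arr, reduceCtorEq, if_false,
        hrank, true_and]
      intro u hu
      by_cases huv : (u : ℕ) = v
      · obtain rfl : u = w := Fin.ext huv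
        simp [huv]
      · rw [if_neg huv]
        exact hI' u (by omega)
  · rintro τ hf hvv ⟨hI, hI'⟩
    simp only [eval_var, St.setV_v, reduceCtorEq, if_false, h.vn] at hI hI'
    rw [rank_self] at hI
    exact ⟨fun w => hI' w w.2, hI⟩

/-! ### Reachability and the test of a mask -/

/-- The set is updated in place, so a pass may also use vertices that it has just added. `Grows`
allows this: it asks for the neighbors of the old set, and for nothing beyond closed supersets. -/
theorem grow_spec (hfit : Fits π n) (h : Base π G M σ) {A Q : Finset (Fin n)}
    (hA : Ind (σ.arr .A) A) (hQ : Ind (σ.arr .Q) Q) :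
    Tri π growCmd σ (fun τ => ∃ Q', Ind (τ.arr .Q) Q' ∧ Grows G A Q Q') := by
  have hp := hfit.p
  have hlin := hfit.lin
  have hN := hfit.N
  let I : ℕ → ℕ → St → Prop := fun i j τ => ∃ Q', Ind (τ.arr .Q) Q' ∧ Q ⊆ Q' ∧
    (∀ x y : Fin n, ((x : ℕ) < i ∨ (x : ℕ) = i ∧ (y : ℕ) < j) → x ∈ A → y ∈ Q → G.Adj x y → x ∈ Q') ∧
    ∀ Z : Finset (Fin n), Q ⊆ Z → (∀ i ∈ A, ∀ j ∈ Z, G.Adj i j → i ∈ Z) → Q' ⊆ Z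
  refine Tri.loop (fun i τ => I i 0 τ) (by simp) rfl ?_ ?_ ?_ ?_
  · simp [Par.bound, h.vn]; omega
  · exact ⟨Q, hQ, Subset.refl _, fun x y hxy => by omega, fun _ hZ _ => hZ⟩
  · intro i τ hi hf hiv hI
    have hb : Base π G M τ := h.frame hf rfl
    have hi' : i < n := by simpa [h.vn] using hi
    refine Tri.loop (fun j τ => I i j τ) (by simp) rfl ?_ ?_ ?_ ?_
    · simp [Par.bound, hb.vn]; omega
    · exact hI
    · rintro j ρ hj hf' hjv ⟨Q', h1, h2, h3, h4⟩
      have hb' : Base π G M ρ := hb.frame hf' rfl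
      have hj' : j < n := by simpa [hb.vn] using hj
      let x : Fin n := ⟨i, hi'⟩
      let y : Fin n := ⟨j, hj'⟩
      have hρi : ρ.v .i = i := (hf'.v _ rfl).trans hiv
      have hadj : ρ.inp (n * i + j) = if G.Adj x y then 1 else 0 := hb'.inp x y
      have hAx : ρ.arr .A i = if x ∈ A then 1 else 0 := by
        rw [(hf'.arr .A rfl).trans (hf.arr .A rfl)]
        exact hA x
      have hQy : ρ.arr .Q j = if y ∈ Q' then 1 else 0 := h1 y
      have hidx := matrix_index_lt hi' hj'
      have hnew : ∀ a b : Fin n, ((a : ℕ) < i ∨ (a : ℕ) = i ∧ (b : ℕ) < j + 1) →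
          ((a : ℕ) < i ∨ (a : ℕ) = i ∧ (b : ℕ) < j) ∨ a = x ∧ b = y := by
        intro a b hab
        simp only [Fin.ext_iff, x, y]
        omega
      refine Tri.ite ?_ (fun hc => Tri.store (by simp) (by simp; exact hfit.L_ne_zero) ?_)
        (fun hc => Tri.skip ?_)
      · simp only [safe_mul, safe_var, safe_inp, safe_arr, safe_add, eval_mul, eval_var, eval_inp,
          eval_arr, eval_add, hρi, hjv, hb'.vn, hadj, hAx, hQy, true_and]
        have := hfit.quad
        have h01 : (if G.Adj x y then 1 else 0) ≤ 1 := by split <;> simp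
        have h02 : (if x ∈ A then 1 else 0) ≤ 1 := by split <;> simp
        have h03 : (if y ∈ Q' then 1 else 0) ≤ 1 := by split <;> simp
        have h04 := Nat.mul_le_mul h01 h02
        have h05 := Nat.mul_le_mul h04 h03
        omega
      · simp only [eval_mul, eval_var, eval_inp, eval_arr, eval_add, hρi, hjv, hb'.vn, hadj, hAx,
          hQy] at hc
        have hxy : G.Adj x y := by by_contra hn; simp [hn] at hc
        have hxA : x ∈ A := by by_contra hn; simp [hn] at hc
        have hyQ : y ∈ Q' := by by_contra hn; simp [hn] at hc
        refine ⟨insert x Q', fun a => ?_, h2.trans (subset_insert _ _), fun a b hab ha hb hadj' => ?_,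
          fun Z hZ hZ' => insert_subset (hZ' x hxA y (h4 Z hZ hZ' hyQ) hxy) (h4 Z hZ hZ')⟩
        · simp only [eval_var, eval_lit, hρi, St.setV_arr, St.setA_arr_self]
          by_cases hax : a = x
          · subst hax
            simp [x]
          · have : (a : ℕ) ≠ i := fun hc => hax (Fin.ext hc)
            rw [if_neg this, h1 a]
            simp [hax]
        · rcases hnew a b hab with hab' | hab'
          · exact mem_insert_of_mem (h3 a b hab' ha hb hadj')
          · rw [hab'.1]
            exact mem_insert_self _ _
      · simp only [eval_mul, eval_var, eval_inp, eval_arr, eval_add, hρi, hjv, hb'.vn, hadj, hAx,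
          hQy] at hc
        refine ⟨Q', h1, h2, fun a b hab ha hb hadj' => ?_, h4⟩
        rcases hnew a b hab with hab' | hab'
        · exact h3 a b hab' ha hb hadj'
        · rw [hab'.1] at ha hadj'
          rw [hab'.2] at hb hadj'
          simp [ha, hadj', h2 hb] at hc
    · rintro ρ hf' hjv ⟨Q', h1, h2, h3, h4⟩
      rw [eval_var, hb.vn] at h3
      exact ⟨Q', h1, h2, fun x y hxy => h3 x y (by omega), h4⟩
  · rintro τ hf hiv ⟨Q', h1, h2, h3, h4⟩
    rw [eval_var, h.vn] at h3
    exact ⟨Q', h1, h2, fun x hx y hy => h3 x y (.inl x.2) hx hy, h4⟩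

theorem count_spec (hfit : Fits π n) (h : Base π G M σ) {Q : Finset (Fin n)}
    (hQ : Ind (σ.arr .Q) Q) : Tri π countCmd σ (fun τ => τ.v .acc = (Q \ M).card) := by
  have hp := hfit.p
  have hlin := hfit.lin
  have hcard : (Q \ M).card ≤ n := by simpa using card_le_univ (Q \ M)
  refine Tri.seq (Tri.assign (by simp) (Tri.loop (fun v τ => τ.v .acc = rank (Q \ M) v) (by simp)
    rfl ?_ ?_ ?_ ?_))
  · simp [Par.bound, h.vn]; omega
  · simp [rank_zero]
  · rintro v τ hv hf hvv hI
    have hv' : v < n := by simpa [h.vn] using hv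
    let w : Fin n := ⟨v, hv'⟩
    have hPw : τ.arr .P v = weight M v := by
      rw [hf.arr .P rfl]
      exact h.P w
    have hQw : τ.arr .Q v = if w ∈ Q then 1 else 0 := by
      rw [hf.arr .Q rfl]
      exact hQ w
    have hval : (1 - weight M v) * (if w ∈ Q then 1 else 0) = if w ∈ Q \ M then 1 else 0 := by
      by_cases hM : w ∈ M
      · have h1 : weight M v ≠ 0 := weight_ne_zero.2 hM
        have h2 : 1 - weight M v = 0 := by omega
        simp [h2, hM]
      · have h1 : weight M v = 0 := weight_of_notMem hM
        simp [h1, hM]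
    have hrank : rank (Q \ M) (v + 1) = rank (Q \ M) v + if w ∈ Q \ M then 1 else 0 := by
      split
      · exact rank_succ_of_mem (v := w) (by assumption)
      · exact rank_succ_of_notMem (v := w) (by assumption)
    have hle : rank (Q \ M) (v + 1) ≤ (Q \ M).card := rank_self (M := Q \ M) ▸ rank_mono hv'
    refine Tri.assign ?_ ?_
    · simp only [safe_add, safe_mul, safe_sub, safe_lit, safe_var, safe_arr, eval_mul, eval_sub,
        eval_lit, eval_arr, eval_var, hvv, hPw, hQw, hval, hI, ← hrank, true_and, and_true]
      have h01 : (if w ∈ Q \ M then 1 else 0) ≤ 1 := by split <;> simp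
      omega
    · simp only [eval_add, eval_mul, eval_sub, eval_lit, eval_arr, eval_var, hvv, hPw, hQw, hval,
        hI, hrank, St.setV_v, reduceCtorEq, if_false, if_true]
  · rintro τ hf hvv hI
    simp only [eval_var, St.setV_v, reduceCtorEq, if_false, h.vn] at hI
    rw [hI, rank_self]

theorem closure_spec (hfit : Fits π n) (h : Base π G M σ) {A Y : Finset (Fin n)}
    (hA : Ind (σ.arr .A) A) (hY : Ind (σ.arr .Q) Y) :
    Tri π (.loop false .r (var .n) growCmd) σ
      (fun τ => ∃ Q, Ind (τ.arr .Q) Q ∧ IsClosure G A Y Q) := by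
  have hp := hfit.p
  refine Tri.loop (fun r τ => ∃ Q, Ind (τ.arr .Q) Q ∧ IsPartialClosure G A Y r Q) (by simp) rfl
    ?_ ?_ ?_ ?_
  · simp [Par.bound, h.vn]; omega
  · exact ⟨Y, hY, isPartialClosure_zero G A Y⟩
  · rintro r τ hr hf hrv ⟨Q, hQ, hI⟩
    refine Tri.mono (grow_spec hfit (h.frame hf rfl) (A := A) (by rwa [hf.arr .A rfl]) hQ)
      fun ρ _ _ ⟨Q', h1, h2⟩ => ⟨Q', h1, hI.succ h2⟩
  · rintro τ hf hrv ⟨Q, hQ, hI⟩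
    rw [eval_var, h.vn] at hI
    exact ⟨Q, hQ, hI.isClosure (by simp)⟩

/-- The mask `X` leads to a solution. -/
def Good (G : SimpleGraph (Fin n)) [DecidableRel G.Adj] (M S : Finset (Fin n)) (k X : ℕ) : Prop :=
  (decode (n := n) (weight M) X).card = k ∧
    covCount G (2 * k - 1) (usable M S X) (decode (weight M) X) ≠ 0 ∧
    ∀ Q, IsClosure G (usable M S X) (decode (weight M) X) Q → k ≤ (Q \ M).card

/-- `Good` quantifies over all closures; by uniqueness the computed one decides, and existence
prevents the condition from being vacuous. -/
theorem IsClosure.unique {V : Type*} {G : SimpleGraph V} {A Y Q Q' : Finset V}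
    (h : IsClosure G A Y Q) (h' : IsClosure G A Y Q') : Q = Q' :=
  Subset.antisymm (h.least _ h'.subset h'.closed) (h'.least _ h.subset h.closed)

/-- The closure is the intersection of all closed sets that contain `Y`. -/
theorem exists_isClosure {V : Type*} [Fintype V] [DecidableEq V] (G : SimpleGraph V)
    (A Y : Finset V) : ∃ Q, IsClosure G A Y Q := by
  classical
  refine ⟨univ.filter fun v => ∀ Z : Finset V, Y ⊆ Z →
    (∀ i ∈ A, ∀ j ∈ Z, G.Adj i j → i ∈ Z) → v ∈ Z, fun v hv => ?_, fun i hi j hj hij => ?_,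
    fun Z h1 h2 v hv => ?_⟩
  · simp only [mem_filter, mem_univ, true_and]
    exact fun Z hZ _ => hZ hv
  · simp only [mem_filter, mem_univ, true_and] at hj ⊢
    exact fun Z h1 h2 => h2 i hi j (hj Z h1 h2) hij
  · exact (mem_filter.1 hv).2 Z h1 h2

theorem check_spec (hfit : Fits π n) (h : Base π G M σ) {S : Finset (Fin n)}
    (hS : Ind (σ.arr .S) S)
    (hT : ∀ X < 2 ^ M.card, σ.arr .T X =
      covCount G (2 * σ.v .k - 1) (usable M S X) (decode (weight M) X)) (hk : σ.v .k ≤ n) :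
    Tri π checkCmd σ (fun τ => τ.v .ok ≠ 0 ↔
      σ.v .k = 0 ∨ ∃ X < 2 ^ M.card, Good G M S (σ.v .k) X) := by
  have hlin := hfit.lin
  have hp := hfit.p
  have hL := hfit.L_ne_zero
  -- The initial value `1 - k` of `ok` is nonzero exactly for `k = 0`, which the empty set settles.
  refine Tri.seq (Tri.assign (by simp [hL]) (Tri.loop (fun X τ => τ.v .ok ≠ 0 ↔
    σ.v .k = 0 ∨ ∃ X' < X, Good G M S (σ.v .k) X') (by simp) rfl ?_ ?_ ?_ ?_))
  · simp [Par.bound, h.q, h.q_le]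
  · simp
    omega
  · intro X τ hX hf hXv hI
    have hb : Base π G M τ := ⟨(hf.v _ rfl).trans h.vn, (hf.v _ rfl).trans h.vn2,
      (hf.v _ rfl).trans h.q, h.q_le, by rw [hf.arr _ rfl]; exact h.P,
      by rw [hf.inp rfl]; exact h.inp⟩
    have hXq : X < 2 ^ M.card := by simpa [h.q] using hX
    refine Tri.seq (Tri.mono (mask_spec hfit hb (S := S) (by rwa [hf.arr .S rfl]))
      fun τ₁ _ f₁ h₁ => Tri.seq (Tri.mono (start_spec hfit (hb.frame f₁ rfl))
      fun τ₂ _ f₂ ⟨h₂, h₂'⟩ => Tri.seq (Tri.mono (closure_spec hfit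
        ((hb.frame f₁ rfl).frame f₂ rfl) (A := usable M S X)
        (Y := decode (weight M) (τ₁.v .X)) ?_ h₂)
      fun τ₃ _ f₃ ⟨Q, h₃, h₃'⟩ => Tri.seq (Tri.mono
        (count_spec hfit (((hb.frame f₁ rfl).frame f₂ rfl).frame f₃ rfl) h₃)
      fun τ₄ _ f₄ h₄ => ?_))))
    · rw [f₂.arr .A rfl, ← hXv]
      exact h₁
    have hX₁ : τ₁.v .X = X := (f₁.v _ rfl).trans hXv
    rw [hX₁] at h₂' h₃'
    have hpc : τ₄.v .pc = (decode (n := n) (weight M) X).card :=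
      ((f₄.v _ rfl).trans (f₃.v _ rfl)).trans h₂'
    have hk₄ : τ₄.v .k = σ.v .k := ((f₄.v _ rfl).trans ((f₃.v _ rfl).trans ((f₂.v _ rfl).trans
      (f₁.v _ rfl)))).trans (hf.v _ rfl)
    have hok₄ : τ₄.v .ok = τ.v .ok := (f₄.v _ rfl).trans ((f₃.v _ rfl).trans ((f₂.v _ rfl).trans
      (f₁.v _ rfl)))
    have hX₄ : τ₄.v .X = X := ((f₄.v _ rfl).trans ((f₃.v _ rfl).trans (f₂.v _ rfl))).trans hX₁
    have hT₄ : τ₄.arr .T = σ.arr .T := ((f₄.arr _ rfl).trans ((f₃.arr _ rfl).trans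
      ((f₂.arr _ rfl).trans (f₁.arr _ rfl)))).trans (hf.arr _ rfl)
    have hTX := hT X hXq
    -- The sum of truncated differences vanishes exactly when `pc = k` and `k ≤ acc`.
    have hgood : Good G M S (σ.v .k) X ↔ ¬ ((τ₄.v .pc - τ₄.v .k) + (τ₄.v .k - τ₄.v .pc) +
        (τ₄.v .k - τ₄.v .acc) ≠ 0) ∧ σ.arr .T X ≠ 0 := by
      rw [hTX, h₄, hk₄, hpc, Good]
      constructor
      · rintro ⟨a1, a2, a3⟩
        have := a3 Q h₃'
        exact ⟨by omega, a2⟩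
      · rintro ⟨a1, a2⟩
        exact ⟨by omega, a2, fun Q' hQ' => by rw [← h₃'.unique hQ']; omega⟩
    have hsucc : (∃ X' < X + 1, Good G M S (σ.v .k) X') ↔
        (∃ X' < X, Good G M S (σ.v .k) X') ∨ Good G M S (σ.v .k) X := by
      constructor
      · rintro ⟨X', h1, h2⟩
        rcases Nat.lt_succ_iff_lt_or_eq.1 h1 with h3 | rfl
        · exact .inl ⟨X', h3, h2⟩
        · exact .inr h2
      · rintro (⟨X', h1, h2⟩ | h2)
        · exact ⟨X', by omega, h2⟩
        · exact ⟨X, by omega, h2⟩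
    have hcard : (Q \ M).card ≤ n := by simpa using card_le_univ (Q \ M)
    have hcard' : (decode (n := n) (weight M) X).card ≤ n := by
      simpa using card_le_univ (decode (n := n) (weight M) X)
    rw [hsucc]
    refine Tri.ite ?_ (fun hc => Tri.skip ?_) (fun hc => Tri.ite (by simp)
      (fun hc' => Tri.assign (by simp [hL]) ?_) (fun hc' => Tri.skip ?_))
    · simp [hpc, hk₄, h₄]
      omega
    · have hn : ¬ Good G M S (σ.v .k) X := fun hg => (hgood.1 hg).1 hc
      simpa [hok₄, hn] using hI
    · simp only [eval_arr, eval_var, hX₄, hT₄] at hc'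
      have hg := hgood.2 ⟨fun hcon => hcon hc, hc'⟩
      simp [hg]
    · simp only [eval_arr, eval_var, hX₄, hT₄] at hc'
      have hn : ¬ Good G M S (σ.v .k) X := fun hg => (hgood.1 hg).2 hc'
      simpa [hok₄, hn] using hI
  · intro τ hf hXv hI
    simpa [h.q] using hI

/-- The case `k = 0` is separate because a branching walk has a root and cannot have empty support.
-/
theorem feasible_iff_good {S : Finset (Fin n)} {k : ℕ} :
    Feasible G M S k ↔ k = 0 ∨ ∃ X < 2 ^ M.card, Good G M S k X := by
  constructor
  · intro h
    rcases Nat.eq_zero_or_pos k with h0 | h0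
    · exact .inl h0
    · obtain ⟨Y, hYM, hY, h1, h2⟩ := covCount_of_feasible h0 h
      obtain ⟨X, hX, rfl⟩ := exists_decode_weight hYM
      exact .inr ⟨X, hX, hY, h1, h2⟩
  · rintro (rfl | ⟨X, hX, h1, h2, h3⟩)
    · exact feasible_zero G M S
    · rcases Nat.eq_zero_or_pos k with rfl | h0
      · exact feasible_zero G M S
      · obtain ⟨Q, hQ⟩ := exists_isClosure G (usable M S X) (decode (weight M) X)
        exact feasible_of_covCount h0 decode_weight_subset h1 h2 hQ (h3 Q hQ)

theorem decide_spec (hfit : Fits π n) (h : Base π G M σ) {S : Finset (Fin n)}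
    (hS : Ind (σ.arr .S) S) (hk : σ.v .k ≤ n) :
    Tri π decideCmd σ (fun τ => τ.v .ok ≠ 0 ↔ Feasible G M S (σ.v .k)) := by
  refine Tri.seq (Tri.mono (table_spec hfit h hS hk) fun τ₁ _ f₁ h₁ => Tri.seq (Tri.mono
    (moebius_spec hfit (h.frame f₁ rfl) h₁) fun τ₂ _ f₂ h₂ => ?_))
  have hk₂ : τ₂.v .k = σ.v .k := (f₂.v _ rfl).trans (f₁.v _ rfl)
  refine Tri.mono (check_spec hfit ((h.frame f₁ rfl).frame f₂ rfl) (S := S) ?_ ?_ (by omega))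
    fun τ₃ _ _ h₃ => ?_
  · rwa [f₂.arr .S rfl, f₁.arr .S rfl]
  · rwa [hk₂]
  · rw [h₃, hk₂, feasible_iff_good]

end

/-! ### Setup and search -/

section

variable {π : Par} {n : ℕ} {G : SimpleGraph (Fin n)} [DecidableRel G.Adj] {M : Finset (Fin n)}
  {σ τ : St}

/-- The smaller color class. -/
def minority (red : Finset (Fin n)) : Finset (Fin n) := if n < 2 * red.card then redᶜ else red

/-- This is where the exponent `n / 2` comes from: masks range over subsets of the smaller class
only. -/
theorem card_minority_le (red : Finset (Fin n)) : (minority red).card ≤ n / 2 := by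
  unfold minority
  split
  · rw [card_compl, Fintype.card_fin]
    omega
  · omega

/-- The variable `q` plays two roles: it is the weight for the next member of `M`, doubling whenever
it is used, and in the end it is the number of masks. -/
theorem setup_spec (hfit : Fits π n) (hg : 2 ^ (n / 2) ≤ π.g) {red : Finset (Fin n)}
    (hn : σ.v .n = n) (hadj : ∀ i j : Fin n, σ.inp (n * i + j) = if G.Adj i j then 1 else 0)
    (hred : ∀ v : Fin n, σ.inp (n * n + v) = if v ∈ red then 1 else 0) :
    Tri π setupCmd σ (fun τ => Base π G (minority red) τ ∧ τ.v .n1 = n + 1 ∧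
      Ind (τ.arr .S) (univ : Finset (Fin n))) := by
  have hlin := hfit.lin
  have hp := hfit.p
  have hN := hfit.N
  have hL := hfit.L_ne_zero
  have hpow := hfit.pow
  have hquad := hfit.quad
  set M := minority red with hM
  have hcardr : red.card ≤ n := by simpa using card_le_univ red
  have hcardM : M.card ≤ n / 2 := card_minority_le red
  have hrankM : ∀ v, v ≤ n → 2 ^ rank M v ≤ 2 ^ n := fun v hv =>
    Nat.pow_le_pow_right (by omega) ((rank_mono hv).trans (by rw [rank_self]; omega))
  refine Tri.seq (Tri.assign (by simp) (Tri.seq (Tri.loop (fun v τ => τ.v .c = rank red v)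
    (by simp) rfl ?_ ?_ ?_ (fun τ₁ f₁ _ h₁ => Tri.seq (Tri.assign ?_ (Tri.seq (Tri.assign ?_
    (Tri.seq (Tri.assign ?_ (Tri.loop (fun v τ => τ.v .q = 2 ^ rank M v ∧ ∀ w : Fin n, (w : ℕ) < v →
      τ.arr .S w = 1 ∧ τ.arr .P w = weight M w) (by simp) rfl ?_ ?_ ?_ ?_))))))))))
  · simp [Par.bound, hn]; omega
  · simp [rank_zero]
  · intro v τ hv hf hvv hI
    have hv' : v < n := by simpa [hn] using hv
    have hτn : τ.v .n = n := (hf.v _ rfl).trans hn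
    have hr : τ.inp (n * n + v) = if (⟨v, hv'⟩ : Fin n) ∈ red then 1 else 0 := by
      rw [hf.inp rfl]
      exact hred ⟨v, hv'⟩
    have hrank : rank red (v + 1) = rank red v + if (⟨v, hv'⟩ : Fin n) ∈ red then 1 else 0 := by
      split
      · exact rank_succ_of_mem (v := ⟨v, hv'⟩) (by assumption)
      · exact rank_succ_of_notMem (v := ⟨v, hv'⟩) (by assumption)
    have hle : rank red (v + 1) ≤ red.card := rank_self (M := red) ▸ rank_mono hv'
    refine Tri.assign ?_ ?_
    · simp only [safe_add, safe_mul, safe_inp, safe_var, eval_add, eval_mul, eval_inp, eval_var,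
        hτn, hvv, hr, hI, ← hrank, true_and]
      omega
    · simp only [eval_add, eval_mul, eval_inp, eval_var, hτn, hvv, hr, hI, hrank, St.setV_v,
        reduceCtorEq, if_false, if_true]
  all_goals
    have hn₁ : τ₁.v .n = n := (f₁.v _ rfl).trans hn
    have hi₁ : τ₁.inp = σ.inp := f₁.inp rfl
    have hc₁ : τ₁.v .c = red.card := by
      rw [h₁]
      simp [hn, rank_self]
  · simp [hn₁, hL]; omega
  · simp [hn₁]; omega
  · simp [hL]
  · simp [hn₁, Par.bound]; omega
  · simp [rank_zero]
  · rintro v τ hv hf hvv ⟨hI, hI'⟩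
    have hv' : v < n := by simpa [hn₁] using hv
    let w : Fin n := ⟨v, hv'⟩
    have hτn : τ.v .n = n := (hf.v _ rfl).trans hn₁
    have hτc : τ.v .c = red.card := (hf.v _ rfl).trans hc₁
    have hr : τ.inp (n * n + v) = if w ∈ red then 1 else 0 := by
      rw [(hf.inp rfl).trans hi₁]
      exact hred w
    have hw : weight M v = (if w ∈ M then 1 else 0) * 2 ^ rank M v := by
      split
      · rw [one_mul]
        exact weight_of_mem (v := w) (by assumption)
      · rw [zero_mul]
        exact weight_of_notMem (v := w) (by assumption)
    have hrank : 2 ^ rank M (v + 1) = 2 ^ rank M v + weight M v := by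
      rw [hw]
      split
      · rw [show rank M (v + 1) = rank M v + 1 from rank_succ_of_mem (v := w) (by assumption)]
        ring
      · rw [show rank M (v + 1) = rank M v from rank_succ_of_notMem (v := w) (by assumption)]
        ring
    have hle := hrankM (v + 1) hv'
    -- The two branches of the color test differ only in how they compute `acc`; everything after it
    -- is treated once for both.
    have hmain : ∀ ρ : St, ρ.v .acc = (if w ∈ M then 1 else 0) → ρ.v .v = v →
        ρ.v .q = 2 ^ rank M v → (∀ u : Fin n, (u : ℕ) < v + 1 → ρ.arr .S u = 1) →
        (∀ u : Fin n, (u : ℕ) < v → ρ.arr .P u = weight M u) →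
        Tri π (.store .P (var .v) (var .acc * var .q) ;; .assign .q (var .q + arr .P (var .v))) ρ
          (fun ρ => (ρ.setV .v (v + 1)).v .q = 2 ^ rank M (v + 1) ∧ ∀ u : Fin n, (u : ℕ) < v + 1 →
            (ρ.setV .v (v + 1)).arr .S u = 1 ∧ (ρ.setV .v (v + 1)).arr .P u = weight M u) := by
      intro ρ hacc hρv hq hS hP
      refine Tri.seq (Tri.store (by simp) ?_ (Tri.assign ?_ ?_))
      · simp only [safe_mul, safe_var, eval_var, hacc, hq, ← hw, true_and]
        omega
      · simp only [safe_add, safe_var, safe_arr, eval_mul, eval_var, eval_arr, St.setA_v,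
          St.setA_arr_self, hacc, hq, hρv, ← hw, if_true, true_and]
        omega
      · simp only [eval_add, eval_mul, eval_var, eval_arr, St.setA_v, St.setA_arr_self, hacc, hq,
          hρv, ← hw, if_true, St.setV_v, St.setV_arr, reduceCtorEq, if_false, hrank, true_and]
        intro u hu
        refine ⟨?_, ?_⟩
        · rw [St.setA_arr_of_ne _ (by simp)]
          exact hS u hu
        · split
          · simp [*]
          · exact hP u (by omega)
    have hS' : ∀ u : Fin n, (u : ℕ) < v + 1 → (τ.setA .S (Ex.eval τ (var .v)) (Ex.eval τ 1)).arr .S u = 1 := by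
      intro u hu
      simp only [eval_var, eval_lit, hvv, St.setA_arr_self]
      split
      · rfl
      · exact (hI' u (by omega)).1
    have hP' : ∀ u : Fin n, (u : ℕ) < v →
        (τ.setA .S (Ex.eval τ (var .v)) (Ex.eval τ 1)).arr .P u = weight M u := by
      intro u hu
      rw [St.setA_arr_of_ne _ (by simp)]
      exact (hI' u hu).2
    have hidx : n * n + v < π.N := by omega
    refine Tri.seq (Tri.store (by simp) (by simp [hL]) (Tri.seq (Tri.ite ?_ (fun hc => ?_)
      (fun hc => ?_))))
    · simp [hτc]; omega
    · refine Tri.assign ?_ (hmain _ ?_ (by simp [hvv]) (by simp [hI]) hS' hP')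
      · simp [hτn, hvv, hL]; omega
      · have hlt : n < 2 * red.card := by
          simp [hτc, hτn] at hc
          omega
        simp only [St.setV_v, if_true, eval_sub, eval_lit, eval_inp, eval_add, eval_mul, eval_var,
          St.setA_inp, St.setA_v, hτn, hvv, hr, hM, minority, if_pos hlt, mem_compl]
        by_cases hwr : w ∈ red <;> simp [hwr]
    · refine Tri.assign ?_ (hmain _ ?_ (by simp [hvv]) (by simp [hI]) hS' hP')
      · simp [hτn, hvv]; omega
      · have hlt : ¬ n < 2 * red.card := by
          simp [hτc, hτn] at hc
          omega
        simp only [St.setV_v, if_true, eval_inp, eval_add, eval_mul, eval_var,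
          St.setA_inp, St.setA_v, hτn, hvv, hr, hM, minority, if_neg hlt]
  · rintro τ hf hvv ⟨hI, hI'⟩
    simp only [eval_var, St.setV_v, reduceCtorEq, if_false, hn₁] at hI hI'
    have hτn : τ.v .n = n := (hf.v _ rfl).trans hn₁
    have hτn2 : τ.v .n2 = n + n := by
      rw [hf.v _ rfl]
      simp [hn₁]
    have hτn1 : τ.v .n1 = n + 1 := by
      rw [hf.v _ rfl]
      simp [hn₁]
    have hτi : τ.inp = σ.inp := (hf.inp rfl).trans hi₁
    rw [rank_self] at hI
    exact ⟨⟨hτn, by omega, hI, (Nat.pow_le_pow_right (by omega) hcardM).trans hg,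
      fun w => (hI' w w.2).2, by rw [hτi]; exact hadj⟩, hτn1, fun w => by simp [(hI' w w.2).1]⟩

theorem Feasible.le {n : ℕ} {G : SimpleGraph (Fin n)} {M : Finset (Fin n)} {S : Finset (Fin n)} {k : ℕ} (h : Feasible G M S k) : k ≤ n := by
  obtain ⟨H, -, h1, -⟩ := h
  have := card_le_univ (H ∩ M)
  rw [Fintype.card_fin] at this
  omega

/-- A single pass of deletions is enough because feasibility is monotone in the selected set: a
vertex that could not be removed earlier cannot be removed from a smaller set either. -/
theorem search_spec (hfit : Fits π n) (h : Base π G M σ) (hn1 : σ.v .n1 = n + 1)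
    (hS : Ind (σ.arr .S) (univ : Finset (Fin n))) :
    Tri π searchCmd σ (fun τ => ∃ k, ∃ H : Finset (Fin n),
      (∀ k', Feasible G M univ k' → k' ≤ k) ∧ Ind (τ.arr .S) H ∧ Feasible G M H k ∧
      ∀ v ∈ H, ¬ Feasible G M (H.erase v) k) := by
  have hp := hfit.p
  have hlin := hfit.lin
  refine Tri.seq (Tri.assign (by simp) (Tri.seq (Tri.loop (fun k τ =>
    Feasible G M univ (τ.v .best) ∧ ∀ k' < k, Feasible G M univ k' → k' ≤ τ.v .best)
    (by simp) rfl ?_ ?_ ?_ (fun τ₁ f₁ _ ⟨h₁, h₁'⟩ => Tri.seq (Tri.assign (by simp) (Tri.loop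
      (fun z τ => ∃ H : Finset (Fin n), Ind (τ.arr .S) H ∧ Feasible G M H (τ₁.v .best) ∧
        ∀ v ∈ H, (v : ℕ) < z → ¬ Feasible G M (H.erase v) (τ₁.v .best)) (by simp) rfl ?_ ?_ ?_ ?_))))))
  · simp [Par.bound, hn1]; omega
  · simpa using feasible_zero G M univ
  · rintro k τ hk hf hkv ⟨hI, hI'⟩
    have hk' : k < n + 1 := by simpa [hn1] using hk
    have hb : Base π G M τ := ⟨(hf.v _ rfl).trans h.vn, (hf.v _ rfl).trans h.vn2,
      (hf.v _ rfl).trans h.q, h.q_le, by rw [hf.arr _ rfl]; exact h.P,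
      by rw [hf.inp rfl]; exact h.inp⟩
    have hS' : Ind (τ.arr .S) (univ : Finset (Fin n)) := by
      rw [hf.arr .S rfl]
      exact hS
    refine Tri.seq (Tri.mono (decide_spec hfit hb hS' (by omega)) fun ρ _ f h₂ =>
      Tri.ite (by simp) (fun hc => Tri.assign (by simp) ?_) (fun hc => Tri.skip ?_))
    all_goals
      have hρk : ρ.v .k = k := (f.v _ rfl).trans hkv
      have hρb : ρ.v .best = τ.v .best := f.v _ rfl
      rw [hkv] at h₂
      rw [eval_var] at hc
    · have := h₂.1 hc
      simp only [eval_var, hρk, St.setV_v, reduceCtorEq, if_false, if_true]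
      exact ⟨this, fun k' hk' _ => by omega⟩
    · simp only [St.setV_v, reduceCtorEq, if_false, hρb]
      refine ⟨hI, fun k' hk' hfk => ?_⟩
      rcases Nat.lt_succ_iff_lt_or_eq.1 hk' with hlt | rfl
      · exact hI' k' hlt hfk
      · exact absurd hc (h₂.2 hfk)
  all_goals
    have hb₁ : Base π G M τ₁ := ⟨(f₁.v _ rfl).trans h.vn, (f₁.v _ rfl).trans h.vn2,
      (f₁.v _ rfl).trans h.q, h.q_le, by rw [f₁.arr _ rfl]; exact h.P,
      by rw [f₁.inp rfl]; exact h.inp⟩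
    have hS₁ : Ind (τ₁.arr .S) (univ : Finset (Fin n)) := by
      rw [f₁.arr .S rfl]
      exact hS
  · simp [Par.bound, hb₁.vn]; omega
  · exact ⟨univ, hS₁, h₁, fun v _ hv => by omega⟩
  · rintro z τ hz hf hzv ⟨H, hI, hI', hI''⟩
    have hz' : z < n := by simpa [hb₁.vn] using hz
    let w : Fin n := ⟨z, hz'⟩
    have hb : Base π G M τ := ⟨(hf.v _ rfl).trans hb₁.vn, (hf.v _ rfl).trans hb₁.vn2,
      (hf.v _ rfl).trans hb₁.q, h.q_le, by rw [hf.arr _ rfl]; exact hb₁.P,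
      by rw [hf.inp rfl]; exact hb₁.inp⟩
    have hτk : τ.v .k = τ₁.v .best := by
      rw [hf.v _ rfl]
      simp
    set ρ := τ.setA .S (Ex.eval τ (var .z)) (Ex.eval τ 0) with hρ
    have hbρ : Base π G M ρ := ⟨hb.vn, hb.vn2, hb.q, hb.q_le, hb.P, hb.inp⟩
    have hIρ : Ind (ρ.arr .S) (H.erase w) := by
      intro v
      simp only [hρ, eval_var, eval_lit, hzv, St.setA_arr_self]
      by_cases hvw : v = w
      · subst hvw
        simp [w]
      · rw [if_neg fun hc => hvw (Fin.ext hc), hI v]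
        simp [hvw]
    refine Tri.seq (Tri.store (by simp) (by simp) (Tri.seq (Tri.mono
      (decide_spec hfit hbρ hIρ (hτk.trans_le h₁.le)) fun ν _ f h₂ =>
      Tri.ite (by simp) (fun hc => Tri.skip ?_)
        (fun hc => Tri.store (by simp) (by simp; exact hfit.L_ne_zero) ?_))))
    all_goals
      have hνS : ν.arr .S = ρ.arr .S := f.arr _ rfl
      have hνz : ν.v .z = z := (f.v _ rfl).trans hzv
      rw [show ρ.v .k = τ₁.v .best from hτk] at h₂
      rw [eval_var] at hc
    · refine ⟨H.erase w, by rw [St.setV_arr, hνS]; exact hIρ, h₂.1 hc, fun v hv hvz hfe => ?_⟩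
      have hvw := (mem_erase.1 hv).1
      have hvz' : (v : ℕ) ≠ z := fun hc => hvw (Fin.ext hc)
      exact hI'' v (mem_erase.1 hv).2 (by omega)
        (hfe.mono (erase_subset_erase v (erase_subset w H)))
    · by_cases hwH : w ∈ H
      · refine ⟨H, fun v => ?_, hI', fun v hv hvz hfe => ?_⟩
        · simp only [eval_var, eval_lit, hνz, St.setV_arr, St.setA_arr_self, hνS]
          by_cases hvw : v = w
          · subst hvw
            simp [w, hwH]
          · rw [if_neg fun hc => hvw (Fin.ext hc), hIρ v]
            simp [hvw]
        · rcases Nat.lt_succ_iff_lt_or_eq.1 hvz with hlt | heq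
          · exact hI'' v hv hlt hfe
          · obtain rfl : v = w := Fin.ext heq
            exact absurd hc (h₂.2 hfe)
      -- Erasing a vertex outside `H` leaves the feasible set `H`, so the test succeeds and the
      -- vertex is not put back by mistake.
      · rw [erase_eq_of_notMem hwH] at h₂
        exact absurd hc (h₂.2 hI')
  · rintro τ hf hzv ⟨H, hI, hI', hI''⟩
    refine ⟨τ₁.v .best, H, fun k' hk' => h₁' k' ?_ hk', hI, hI', fun v hv =>
      hI'' v hv ?_⟩
    · have := hk'.le
      simp [hn1]
      omega
    · simp [hb₁.vn]

theorem output_spec (hfit : Fits π n) (hn : σ.v .n = n) :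
    Tri π (.loop false .v (var .n) (.out (var .v) (arr .S (var .v)))) σ
      (fun τ => ∀ v < n, τ.inp v = σ.arr .S v) := by
  have hp := hfit.p
  have hN := hfit.N
  refine Tri.loop (fun v τ => ∀ w < v, τ.inp w = σ.arr .S w) (by simp) rfl ?_ ?_ ?_ ?_
  · simp [Par.bound, hn]; omega
  · intro v hv
    omega
  · intro v τ hv hf hvv hI
    have hv' : v < n := by simpa [hn] using hv
    refine Tri.out (by simp) (by simp) ?_ ?_
    · rw [eval_var, hvv]
      have : 0 ≤ n * n := Nat.zero_le _
      omega
    · intro w hw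
      simp only [eval_var, eval_arr, hvv, St.setV_inp, St.setI_inp, hf.arr .S rfl]
      split
      · simp [*]
      · exact hI w (by omega)
  · intro τ hf hvv hI v hv
    exact hI v (by simpa [hn] using hv)

end

/-! ### Optimality -/

section

variable {n : ℕ} {G : SimpleGraph (Fin n)} {red : Finset (Fin n)}

/-- Balance is symmetric in the two colors, so the smaller class may take the place of `red`. -/
theorem isBalanced_iff {H : Finset (Fin n)} :
    IsBalanced red H ↔ (H ∩ minority red).card = (H \ minority red).card := by
  unfold minority IsBalanced
  split
  · rw [sdiff_compl, ← sdiff_eq_inter_compl]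
    rfl
  · exact eq_comm

/-- The witness of feasibility inside `H` cannot miss a vertex of `H`, for that vertex could then be
deleted. So `H` itself is the witness and has `2 * k` vertices. -/
theorem isMaximumBCS_of_minimal {H : Finset (Fin n)} {k : ℕ}
    (hmax : ∀ k', Feasible G (minority red) univ k' → k' ≤ k) (hH : Feasible G (minority red) H k)
    (hmin : ∀ v ∈ H, ¬ Feasible G (minority red) (H.erase v) k) : IsMaximumBCS G red H := by
  obtain ⟨K, hKH, h1, h2, h3⟩ := hH
  have hK : K = H := by
    refine Subset.antisymm hKH fun v hv => ?_
    by_contra hvK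
    exact hmin v hv ⟨K, subset_erase.2 ⟨hKH, hvK⟩, h1, h2, h3⟩
  subst hK
  refine ⟨⟨isBalanced_iff.2 (h1.trans h2.symm), h3⟩, fun H' ⟨hb, hc⟩ => ?_⟩
  have hb' := isBalanced_iff.1 hb
  have := hmax _ ⟨H', subset_univ _, rfl, hb'.symm, hc⟩
  have e1 := card_inter_add_card_sdiff H' (minority red)
  have e2 := card_inter_add_card_sdiff K (minority red)
  omega

theorem main_spec [DecidableRel G.Adj] {π : Par} {σ : St} (hfit : Fits π n)
    (hg : 2 ^ (n / 2) ≤ π.g) (hn : σ.v .n = n)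
    (hadj : ∀ i j : Fin n, σ.inp (n * i + j) = if G.Adj i j then 1 else 0)
    (hred : ∀ v : Fin n, σ.inp (n * n + v) = if v ∈ red then 1 else 0) :
    Tri π mainCmd σ (fun τ => ∃ H : Finset (Fin n), Ind τ.inp H ∧ IsMaximumBCS G red H) := by
  refine Tri.seq (Tri.mono (setup_spec hfit hg hn hadj hred) fun τ₁ _ _ ⟨h₁, h₂, h₃⟩ =>
    Tri.seq (Tri.mono (search_spec hfit h₁ h₂ h₃) fun τ₂ _ f₂ ⟨k, H, h₄, h₅, h₆, h₇⟩ =>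
    Tri.mono (output_spec hfit ((f₂.v _ rfl).trans h₁.vn)) fun τ₃ _ _ h₈ =>
      ⟨H, fun v => ?_, isMaximumBCS_of_minimal h₄ h₆ h₇⟩))
  rw [h₈ v v.2]
  exact h₅ v

end

end BCS

namespace BCS

open ForLang Finset

/-! ### The machine program -/

/-- The program for the machine: store the size of the input in register `1`, then run the
compiled program. -/
def machineProg : RAM.Prog :=
  .seq (.arith .mul 1 0 0) (.seq (.arith .add 1 1 0) (mainCmd.comp 1))

section

variable {n : ℕ} (G : SimpleGraph (Fin n)) (red : Finset (Fin n))

open Classical in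
theorem bcsInput_adj (i j : Fin n) :
    (bcsInput G red).mem (n * i + j) = if G.Adj i j then 1 else 0 := by
  have hlt := matrix_index_lt i.2 j.2
  refine if_congr ⟨?_, fun h => .inl ⟨i, j, h, rfl⟩⟩ rfl rfl
  rintro (⟨i', j', h, he⟩ | ⟨v, -, hv⟩)
  · rw [mul_comm n, mul_comm n] at he
    obtain ⟨h1, h2⟩ := row_index_inj j.2 j'.2 he
    rwa [Fin.ext h1, Fin.ext h2]
  · rw [pow_two] at hv
    omega

theorem bcsInput_red (v : Fin n) :
    (bcsInput G red).mem (n * n + v) = if v ∈ red then 1 else 0 := by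
  classical
  refine if_congr ⟨?_, fun h => .inr ⟨v, h, by rw [pow_two]⟩⟩ rfl rfl
  rintro (⟨i, j, -, he⟩ | ⟨w, hw, he⟩)
  · have := matrix_index_lt i.2 j.2
    omega
  · rw [pow_two] at he
    rwa [show v = w from Fin.ext (by omega)]

theorem bcsInput_of_le {a : ℕ} (ha : n * n + n ≤ a) : (bcsInput G red).mem a = 0 := by
  simp only [bcsInput, ite_eq_right_iff, one_ne_zero, imp_false]
  rintro (⟨i, j, -, he⟩ | ⟨w, hw, he⟩)
  · have := matrix_index_lt i.2 j.2
    omega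
  · rw [pow_two] at he
    omega

theorem bcsInput_le_one (a : ℕ) : (bcsInput G red).mem a ≤ 1 := by
  simp only [bcsInput]
  split <;> simp

end

/-- The bound on the bit lengths. -/
def bits (n : ℕ) : ℕ := (n + 1) * (2 * n) ^ 2 + 2 * n + 4

theorem quad_lt_two_pow_bits (n : ℕ) : 4 * (n + 1) * (n + 1) < 2 ^ bits n := by
  have h : n + 1 ≤ 2 ^ n := Nat.lt_two_pow_self
  calc 4 * (n + 1) * (n + 1) ≤ 4 * 2 ^ n * 2 ^ n := by gcongr
    _ = 2 ^ (2 * n + 2) := by ring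
    _ < 2 ^ bits n := Nat.pow_lt_pow_right (by omega) (by unfold bits; omega)

/-- The parameters for instances with `n` vertices. -/
def params (n : ℕ) : Par where
  N := n * n + n
  L := bits n
  p := 2 * n + 1
  g := 2 ^ (n / 2)
  N_lt := by
    have := quad_lt_two_pow_bits n
    nlinarith

theorem fits_params (n : ℕ) : Fits (params n) n where
  N := rfl
  p := le_rfl
  walk := by
    have h : n < 2 ^ n := Nat.lt_two_pow_self
    calc n * 2 ^ ((n + 1) * (2 * n) ^ 2) ≤ 2 ^ n * 2 ^ ((n + 1) * (2 * n) ^ 2) := by gcongr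
      _ = 2 ^ (n + (n + 1) * (2 * n) ^ 2) := by rw [pow_add]
      _ < 2 ^ bits n := Nat.pow_lt_pow_right (by omega) (by unfold bits; omega)
  idx := quad_lt_two_pow_bits n
  pow := by
    calc 4 * 2 ^ n = 2 ^ (n + 2) := by ring
      _ < 2 ^ bits n := Nat.pow_lt_pow_right (by omega) (by unfold bits; omega)

/-- The table, the inclusion-exclusion and the test loop over the masks one after the other, never
inside each other; otherwise `2 ^ (n / 2)` would enter the cost with a higher power. -/
theorem mainCmd_depth : mainCmd.depth true = 1 := by decide

theorem machineProg_ends {n : ℕ} (G : SimpleGraph (Fin n)) (red : Finset (Fin n)) :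
    RAM.Ends machineProg (bcsInput G red)
      ((mainCmd.cost (params n) + 2) * RAM.stepCost (bits n))
      (fun s => ∃ H : Finset (Fin n), BCSOutput s H ∧ IsMaximumBCS G red H) := by
  classical
  have hfit := fits_params n
  have hlin : 4 * n + 4 < 2 ^ bits n := hfit.lin
  have hquad : 4 * (n * n) + 8 * n + 4 < 2 ^ bits n := hfit.quad
  have h16 := two_pow_add_four (bits n)
  let σ : St := ⟨fun x => if x = .n then n else 0, fun _ _ => 0, (bcsInput G red).mem⟩
  have hσ : σ.Bdd (params n) := by
    refine ⟨fun x => ?_, fun _ _ => ?_, fun i => ?_⟩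
    · change (if x = .n then n else 0) < 2 ^ bits n
      split <;> omega
    · change 0 < 2 ^ bits n
      omega
    · have := bcsInput_le_one G red i
      change (bcsInput G red).mem i < 2 ^ bits n
      omega
  have h0 : (bcsInput G red).reg 0 = n := rfl
  refine RAM.Ends.mono (RAM.Ends.seq (RAM.Ends.arith (L := bits n) ?_ ?_
    (RAM.Ends.seq (RAM.Ends.arith (L := bits n) ?_ ?_ (RAM.Ends.mono (main_spec (σ := σ)
      (red := red) (G := G) hfit le_rfl ?_ ?_ ?_ hσ 1 _ le_rfl ?_) le_rfl
      fun s ⟨τ, _, ⟨H, h1, h2⟩, _, h3, _⟩ => ⟨H, fun v => ?_, h2⟩)))))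
    (le_of_eq (by simp only [params]; ring)) fun _ h => h
  · rw [h0]; omega
  · rw [h0]; omega
  · simp [h0, RAM.Op.eval]; omega
  · simp [h0]; omega
  · rfl
  · exact bcsInput_adj G red
  · exact bcsInput_red G red
  · refine ⟨fun x => ?_, ?_, fun a i => ?_, fun i _ => rfl⟩
    · have h1 : 2 * x.idx ≠ 1 := by omega
      -- The variable `n` has position `0`, so the input register `0` already holds it; the other
      -- variables start at `0` like their registers.
      cases x <;> rfl
    · simp [h0, RAM.Op.eval, params]
    · exact bcsInput_of_le G red (by change _ ≤ n * n + n + 8 * i + a.idx; omega)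
  · rw [h3.inp v (by change (v : ℕ) < n * n + n; omega)]
    exact h1 v

theorem stepCost_bits_le (n : ℕ) : RAM.stepCost (bits n) ≤ 30 * (n + 1) ^ 3 := by
  unfold RAM.stepCost bits
  nlinarith [Nat.zero_le (n ^ 3), Nat.zero_le (n ^ 2)]

theorem cost_le (n : ℕ) : (mainCmd.cost (params n) + 2) * RAM.stepCost (bits n) ≤
    (mainCmd.size * 2 ^ mainCmd.depth false + 2) * 30 * 2 ^ (n / 2) *
      (n + 1) ^ (mainCmd.depth false + 3) := by
  have h := Cmd.cost_le (π := params n) (by simp [params]) Nat.one_le_two_pow mainCmd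
  rw [mainCmd_depth, pow_one] at h
  have h1 : 1 ≤ (n + 1) ^ mainCmd.depth false * 2 ^ (n / 2) :=
    Nat.one_le_iff_ne_zero.2 (by positivity)
  have h2 : (params n).p ≤ 2 * (n + 1) := by
    change 2 * n + 1 ≤ _
    omega
  calc (mainCmd.cost (params n) + 2) * RAM.stepCost (bits n)
      ≤ (mainCmd.size * (2 * (n + 1)) ^ mainCmd.depth false * 2 ^ (n / 2) +
          2 * ((n + 1) ^ mainCmd.depth false * 2 ^ (n / 2))) * (30 * (n + 1) ^ 3) := by
        refine Nat.mul_le_mul (Nat.add_le_add (h.trans ?_) ?_) (stepCost_bits_le n)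
        · exact Nat.mul_le_mul_right _ (Nat.mul_le_mul_left _ (Nat.pow_le_pow_left h2 _))
        · omega
    _ = _ := by
        rw [mul_pow, pow_add]
        ring

end BCS

theorem mainTheorem1 :
    ∃ (P : RAM.Prog) (C k : ℕ),
      SolvesBCSInTime P
        (fun n : ℕ => (C : ℝ) * (2 : ℝ) ^ ((n : ℝ) / 2) * ((n : ℝ) + 1) ^ k) := by
  refine ⟨BCS.machineProg, (BCS.mainCmd.size * 2 ^ BCS.mainCmd.depth false + 2) * 30,
    BCS.mainCmd.depth false + 3, fun n G red => ?_⟩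
  obtain ⟨s, t, h1, h2, H, h3, h4⟩ := BCS.machineProg_ends G red
  refine ⟨s, t, H, h1, ?_, h3, h4⟩
  -- The exponent on the left is the rounded-down natural quotient, the one on the right is real.
  have h5 : (2 : ℝ) ^ (n / 2) ≤ (2 : ℝ) ^ ((n : ℝ) / 2) := by
    rw [← Real.rpow_natCast]
    refine Real.rpow_le_rpow_of_exponent_le one_le_two ?_
    exact_mod_cast Nat.cast_div_le (α := ℝ) (m := n) (n := 2)
  have h6 : (t : ℝ) ≤ _ := Nat.cast_le.2 (h2.trans (BCS.cost_le n))
  refine h6.trans ?_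
  push_cast
  gcongr
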